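/- **Setting.** Let $k\ge 1$, $n>k$, and let $x_1,\dots,x_n\in\mathbb R^k$ be observed return vectors which, given a mean vector $\mu\in\mathbb R^k$ and a positive definite covariance matrix $\Sigma\in\mathbb R^{k\times k}$, are independent with distribution $\mathcal N_k(\mu,\Sigma)$. For a prior $\pi(\mu,\Sigma)$ (a density with respect to Lebesgue measure $d\mu\,d\Sigma$, with $\Sigma$ ranging over the positive definite matrices) the posterior is the probability distribution with density proportional to $\pi(\mu,\Sigma)\prod_{i=1}^n\varphi_{\mu,\Sigma}(x_i)$, where $\varphi_{\mu,\Sigma}$ is the density of $\mathcal N_k(\mu,\Sigma)$. Write $\bar x=\frac1n\sum_i x_i$ and $S_d=\sum_{i=1}^n(x_i-\bar x)(x_i-\bar x)^\top$. Let $t<T$ be time points, $\gamma>0$ the risk aversion, $W_t$ the wealth at time $t$, $r_{f,i}$ the risk-free returns, $C_t=\big(\gamma W_t\prod_{i=t+2}^T(1+r_{f,i})\big)^{-1}$ (all non-random, the empty product being $1$), and let $$w_t=C_t\,\Sigma^{-1}(\mu-r_{f,t+1}\mathbf 1)$$ be the multi-period optimal portfolio weights. Let $L$ be a $p\times k$ matrix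 of constants, and let $t_k(d,a,A)$ denote the $k$-variate $t$-distribution with $d$ degrees of freedom, location $a$ and dispersion matrix $A$. **Theorem.** (a) *Diffuse (Jeffreys) prior* $\pi(\mu,\Sigma)\propto|\Sigma|^{-(k+1)/2}$. Suppose that $S_d$ is positive definite. Then the posterior is proper and under it $$L w_t\overset{d}{=}C_t\,\eta\,L S^*(\mu)^{-1}v+C_t\sqrt{\eta}\,\Big(v^\top S^*(\mu)^{-1}v\cdot L S^*(\mu)^{-1}L^\top-L S^*(\mu)^{-1}v\,v^\top S^*(\mu)^{-1}L^\top\Big)^{1/2}z_0,\qquad v=\mu-r_{f,t+1}\mathbf 1,\tag{$*$}$$ with $S^*(\mu)=S_d+n(\mu-\bar x)(\mu-\bar x)^\top$, where on the right-hand side $\eta\sim\chi^2_n$, $z_0\sim\mathcal N_p(0,I_p)$ and $\mu\sim t_k\big(n-k,\ \bar x,\ \tfrac{1}{n(n-k)}S_d\big)$ are mutually independent; this $t$-distribution is the marginal posterior of $\mu$. The exponent $1/2$ denotes the positive semidefinite square root. (b) *Conjugate prior* $\mu\mid\Sigma\sim\mathcal N_k(m_0,\Sigma/r_0)$, $\Sigma\sim\mathcal{IW}_k(d_0,S_0)$,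 where $m_0\in\mathbb R^k$, $r_0>0$, $d_0>2k$, $S_0$ is positive definite, and $\mathcal{IW}_k(d_0,S_0)$ has density proportional to $|\Sigma|^{-d_0/2}\exp\{-\tfrac12\mathrm{tr}(\Sigma^{-1}S_0)\}$. Put $$\bar x_c=\frac{n\bar x+r_0m_0}{n+r_0},\qquad S_c=S_d+S_0+\frac{n r_0}{n+r_0}(m_0-\bar x)(m_0-\bar x)^\top .$$ Then the posterior is proper and under it $(*)$ holds with $S^*(\mu)=S_c+(n+r_0)(\mu-\bar x_c)(\mu-\bar x_c)^\top$, where now on the right-hand side $\eta\sim\chi^2_{n+d_0-k}$, $z_0\sim\mathcal N_p(0,I_p)$ and $\mu\sim t_k\big(n+d_0-2k,\ \bar x_c,\ \tfrac{1}{(n+r_0)(n+d_0-2k)}S_c\big)$ are mutually independent; this $t$-distribution is the marginal posterior of $\mu$. -/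

import Mathlib

open MeasureTheory ProbabilityTheory Matrix
open scoped MatrixOrder ENNReal

noncomputable section

namespace BayesPortfolio

/-! ### Lebesgue measure on symmetric matrices and the distributions involved -/

/-- The symmetric matrix with prescribed entries on and above the diagonal. -/
def symMatrix {k : ℕ} (u : {q : Fin k × Fin k // q.1 ≤ q.2} → ℝ) : Matrix (Fin k) (Fin k) ℝ :=
  Matrix.of fun i j => u ⟨(min i j, max i j), min_le_max⟩

/-- The σ-algebra on real matrices generated by the entries. -/
instance matrixMeasurableSpace {m n : ℕ} : MeasurableSpace (Matrix (Fin m) (Fin n) ℝ) :=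
  inferInstanceAs (MeasurableSpace (Fin m → Fin n → ℝ))

/-- The reference measure `dμ dΣ` on pairs `(μ, Σ)`: Lebesgue measure on `ℝᵏ` for `μ`, and
for `Σ` Lebesgue measure in the `k (k + 1) / 2` entries on and above the diagonal, restricted
to the cone of positive definite matrices. -/
def refMeasure (k : ℕ) : Measure ((Fin k → ℝ) × Matrix (Fin k) (Fin k) ℝ) :=
  (volume : Measure (Fin k → ℝ)).prod
    (((volume : Measure ({q : Fin k × Fin k // q.1 ≤ q.2} → ℝ)).map symMatrix).restrict
      {S | S.PosDef})

/-- The density at `y` of the normal distribution `N_k(m, S)`, for `S` positive definite. -/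
def normalDensity {k : ℕ} (m : Fin k → ℝ) (S : Matrix (Fin k) (Fin k) ℝ) (y : Fin k → ℝ) : ℝ :=
  (2 * Real.pi) ^ (-(k : ℝ) / 2) * S.det ^ (-(1 : ℝ) / 2) *
    Real.exp (-((y - m) ⬝ᵥ (S⁻¹ *ᵥ (y - m))) / 2)

/-- The multivariate gamma function `Γ_k(a) = π^(k(k-1)/4) ∏_{i=1}^k Γ(a - (i-1)/2)`. -/
def multiGamma (k : ℕ) (a : ℝ) : ℝ :=
  Real.pi ^ ((k : ℝ) * ((k : ℝ) - 1) / 4) * ∏ i : Fin k, Real.Gamma (a - ((i : ℕ) : ℝ) / 2)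

/-- The density at `S` of the inverse Wishart distribution `IW_k(d, Ψ)`, for `d > 2k` and `Ψ`
positive definite, in the parametrization where it is proportional to
`|S|^(-d/2) exp(-tr(S⁻¹ Ψ)/2)`. -/
def invWishartDensity {k : ℕ} (d : ℝ) (Ψ S : Matrix (Fin k) (Fin k) ℝ) : ℝ :=
  Ψ.det ^ ((d - k - 1) / 2) / (2 ^ ((k : ℝ) * (d - k - 1) / 2) * multiGamma k ((d - k - 1) / 2)) *
    S.det ^ (-d / 2) * Real.exp (-(S⁻¹ * Ψ).trace / 2)

/-- The multivariate `t`-distribution `t_k(d, a, A)` with `d` degrees of freedom, location `a`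
and dispersion matrix `A`. -/
def multiT {k : ℕ} (d : ℝ) (a : Fin k → ℝ) (A : Matrix (Fin k) (Fin k) ℝ) :
    Measure (Fin k → ℝ) :=
  volume.withDensity fun y => ENNReal.ofReal
    (Real.Gamma ((d + k) / 2) /
        (Real.Gamma (d / 2) * (d * Real.pi) ^ ((k : ℝ) / 2) * A.det ^ ((1 : ℝ) / 2)) *
      (1 + (y - a) ⬝ᵥ (A⁻¹ *ᵥ (y - a)) / d) ^ (-(d + k) / 2))

/-- The `χ²`-distribution with `d` degrees of freedom. -/
def chiSquared (d : ℝ) : Measure ℝ := gammaMeasure (d / 2) (1 / 2)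

/-! ### Priors and posteriors -/

/-- The diffuse (Jeffreys) prior, with density `|Σ|^(-(k+1)/2)`; it has infinite mass. -/
def diffusePrior (k : ℕ) : Measure ((Fin k → ℝ) × Matrix (Fin k) (Fin k) ℝ) :=
  (refMeasure k).withDensity fun θ => ENNReal.ofReal (θ.2.det ^ (-((k : ℝ) + 1) / 2))

/-- The conjugate prior: `μ | Σ ~ N_k(m₀, Σ / r₀)` and `Σ ~ IW_k(d₀, S₀)`. -/
def conjugatePrior {k : ℕ} (m₀ : Fin k → ℝ) (r₀ d₀ : ℝ) (S₀ : Matrix (Fin k) (Fin k) ℝ) :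
    Measure ((Fin k → ℝ) × Matrix (Fin k) (Fin k) ℝ) :=
  (refMeasure k).withDensity fun θ => ENNReal.ofReal
    (normalDensity m₀ (r₀⁻¹ • θ.2) θ.1 * invWishartDensity d₀ S₀ θ.2)

/-- The likelihood of the parameter `θ = (μ, Σ)` for observations `x` that are independent
`N_k(μ, Σ)` vectors given `(μ, Σ)`. -/
def likelihood {k n : ℕ} (x : Fin n → Fin k → ℝ)
    (θ : (Fin k → ℝ) × Matrix (Fin k) (Fin k) ℝ) : ℝ :=
  ∏ i, normalDensity θ.1 θ.2 (x i)

/-- The posterior given `x`: likelihood times prior, normalized to total mass one. -/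
def posterior {k n : ℕ} (prior : Measure ((Fin k → ℝ) × Matrix (Fin k) (Fin k) ℝ))
    (x : Fin n → Fin k → ℝ) : Measure ((Fin k → ℝ) × Matrix (Fin k) (Fin k) ℝ) :=
  (∫⁻ θ, ENNReal.ofReal (likelihood x θ) ∂prior)⁻¹ •
    prior.withDensity fun θ => ENNReal.ofReal (likelihood x θ)

/-! ### Sample statistics -/

/-- The sample mean `x̄`. -/
def sampleMean {k n : ℕ} (x : Fin n → Fin k → ℝ) : Fin k → ℝ :=
  (n : ℝ)⁻¹ • ∑ i, x i

/-- The sample covariance matrix, with the factor `1 / (n - 1)`. -/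
def sampleCov {k n : ℕ} (x : Fin n → Fin k → ℝ) : Matrix (Fin k) (Fin k) ℝ :=
  ((n : ℝ) - 1)⁻¹ • ∑ i, vecMulVec (x i - sampleMean x) (x i - sampleMean x)

/-- `S_d = (n - 1) S`. -/
def scaleD {k n : ℕ} (x : Fin n → Fin k → ℝ) : Matrix (Fin k) (Fin k) ℝ :=
  ((n : ℝ) - 1) • sampleCov x

/-- `S_d*(μ) = S_d + n (μ - x̄)(μ - x̄)ᵀ`. -/
def scaleDStar {k n : ℕ} (x : Fin n → Fin k → ℝ) (μ : Fin k → ℝ) : Matrix (Fin k) (Fin k) ℝ :=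
  scaleD x + (n : ℝ) • vecMulVec (μ - sampleMean x) (μ - sampleMean x)

/-- `x̄_c = (n x̄ + r₀ m₀) / (n + r₀)`. -/
def meanC {k n : ℕ} (m₀ : Fin k → ℝ) (r₀ : ℝ) (x : Fin n → Fin k → ℝ) : Fin k → ℝ :=
  ((n : ℝ) + r₀)⁻¹ • ((n : ℝ) • sampleMean x + r₀ • m₀)

/-- `S_c = S_d + S₀ + (n r₀ / (n + r₀)) (m₀ - x̄)(m₀ - x̄)ᵀ`. -/
def scaleC {k n : ℕ} (m₀ : Fin k → ℝ) (r₀ : ℝ) (S₀ : Matrix (Fin k) (Fin k) ℝ)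
    (x : Fin n → Fin k → ℝ) : Matrix (Fin k) (Fin k) ℝ :=
  scaleD x + S₀ +
    ((n : ℝ) * r₀ / ((n : ℝ) + r₀)) • vecMulVec (m₀ - sampleMean x) (m₀ - sampleMean x)

/-- `S_c*(μ) = S_c + (n + r₀) (μ - x̄_c)(μ - x̄_c)ᵀ`. -/
def scaleCStar {k n : ℕ} (m₀ : Fin k → ℝ) (r₀ : ℝ) (S₀ : Matrix (Fin k) (Fin k) ℝ)
    (x : Fin n → Fin k → ℝ) (μ : Fin k → ℝ) : Matrix (Fin k) (Fin k) ℝ :=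
  scaleC m₀ r₀ S₀ x + ((n : ℝ) + r₀) • vecMulVec (μ - meanC m₀ r₀ x) (μ - meanC m₀ r₀ x)

/-! ### Portfolio weights and the stochastic representation -/

/-- `C_t = (γ W_t ∏_{i=t+2}^T R_{f,i})⁻¹` with `R_{f,i} = 1 + r_{f,i}`. -/
def riskCoeff (γ : ℝ) (W rf : ℕ → ℝ) (T t : ℕ) : ℝ :=
  (γ * W t * ∏ i ∈ Finset.Icc (t + 2) T, (1 + rf i))⁻¹

/-- The optimal weights `w_t = C_t Σ⁻¹ (μ - r_{f,t+1} 𝟏)` for the parameter `θ = (μ, Σ)`. -/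
def optWeights {k : ℕ} (γ : ℝ) (W rf : ℕ → ℝ) (T t : ℕ)
    (θ : (Fin k → ℝ) × Matrix (Fin k) (Fin k) ℝ) : Fin k → ℝ :=
  riskCoeff γ W rf T t • (θ.2⁻¹ *ᵥ (θ.1 - rf (t + 1) • (1 : Fin k → ℝ)))

/-- The random vector
`C η L V v + C √η (vᵀ V v · L V Lᵀ - L V v vᵀ V Lᵀ)^(1/2) z₀` with `V = S*(μ)⁻¹` and
`v = μ - r 𝟏`, as a function of `(η, z₀, μ)`; the square root is the positive semidefinite one. -/
def stochRep {k p : ℕ} (C r : ℝ) (L : Matrix (Fin p) (Fin k) ℝ)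
    (Sstar : (Fin k → ℝ) → Matrix (Fin k) (Fin k) ℝ)
    (ω : ℝ × EuclideanSpace ℝ (Fin p) × (Fin k → ℝ)) : Fin p → ℝ :=
  let η := ω.1
  let z₀ := ω.2.1
  let μ := ω.2.2
  let V := (Sstar μ)⁻¹
  let v := μ - r • (1 : Fin k → ℝ)
  (C * η) • ((L * V) *ᵥ v) +
    (C * Real.sqrt η) •
      (CFC.sqrt ((v ⬝ᵥ (V *ᵥ v)) • (L * V * Lᵀ) - L * V * vecMulVec v v * V * Lᵀ) *ᵥ z₀.ofLp)

end BayesPortfolio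

end

/-! Up to a positive constant, each posterior has density `|Σ|^(-d/2) exp(-tr(Σ⁻¹ S*(μ))/2)` with
respect to `dμ dΣ`, where `S*(μ) = S + r (μ - m)(μ - m)ᵀ`: the likelihood already has this form, and
for the conjugate prior one completes the square in `μ`. Everything else concerns this kernel.

Fix `μ` and integrate over `Σ`, which is then inverse Wishart with scale `S*(μ)`. Factor `S*(μ) = A
Aᵀ` with `v = a • A e₀` (a square root times a Householder reflection) and substitute `Σ = A T Aᵀ`.
This reduces the scale to the identity, at the price of the power `|S*(μ)|^(-ν/2)`, and `Σ⁻¹ v`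
becomes `a • (Aᵀ)⁻¹ (T⁻¹ e₀)`. If `s` is the Schur complement of the lower right block of `T` and
`β` its vector of regression coefficients, then `T⁻¹ e₀ = s⁻¹ (1, -β)`, and the kernel separates
`(s, β)` from the remaining block. Setting `η = 1/s` and `z = -√η β` gives `T⁻¹ e₀ = (η, √η z)` with
`η ∼ χ²_ν` and `z` standard normal, independent of each other.

Hence, given `μ` and `η`, `L Σ⁻¹ v` is Gaussian with mean `η L S*(μ)⁻¹ v` and covariance `η` times
the matrix under the square root in the representation. Any other square root of that covariance, in
particular the positive semidefinite one, yields the same law. As the law of `(η, z₀)` does not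
depend on `μ`, the three variables are independent. The leftover factor `|S*(μ)|^(-ν/2)` is, by the
matrix determinant lemma, a multivariate `t` kernel, which gives the marginal of `μ`.

All laws are compared through Lebesgue integrals of arbitrary measurable functions with values in
`ℝ≥0∞`. Properness of the posterior is then the case of the test function `1`, and the normalizing
constant of the inverse Wishart kernel need only be nonzero and finite. The carrying lemmas are
`lintegral_posDefVolume_succ`, `lintegral_posDefVolume_congr`, `lintegral_schur_kernel`,
`lintegral_invWishart` and `lintegral_niwKernel`; `posterior_of_niwKernel` assembles them for both
priors. -/

noncomputable section

namespace BayesPortfolio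

/-! ### Bordered matrices -/

/-- The matrix with upper left entry `c`, lower right block `T`, and first row and column
completed by `b`. -/
def bordered {k : ℕ} (c : ℝ) (b : Fin k → ℝ) (T : Matrix (Fin k) (Fin k) ℝ) :
    Matrix (Fin (k + 1)) (Fin (k + 1)) ℝ :=
  Matrix.of (Fin.cons (Fin.cons c b) fun i => Fin.cons (b i) (T i))

section bordered

variable {k : ℕ} (c : ℝ) (b : Fin k → ℝ) (T : Matrix (Fin k) (Fin k) ℝ)

@[simp] lemma bordered_zero_zero : bordered c b T 0 0 = c := rfl
@[simp] lemma bordered_zero_succ (j : Fin k) : bordered c b T 0 j.succ = b j := rfl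
@[simp] lemma bordered_succ_zero (i : Fin k) : bordered c b T i.succ 0 = b i := rfl
@[simp] lemma bordered_succ_succ (i j : Fin k) : bordered c b T i.succ j.succ = T i j := rfl

/-- The bordered matrix with lower right block `T`, Schur complement `s` and regression
coefficients `β`. -/
def schurMatrix {k : ℕ} (s : ℝ) (β : Fin k → ℝ) (T : Matrix (Fin k) (Fin k) ℝ) :
    Matrix (Fin (k + 1)) (Fin (k + 1)) ℝ :=
  bordered (s + β ⬝ᵥ (T *ᵥ β)) (T *ᵥ β) T

variable {c b T}

lemma isSymm_bordered (hT : T.IsSymm) : (bordered c b T).IsSymm := by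
  ext i j
  refine Fin.cases ?_ (fun i => ?_) i <;> refine Fin.cases ?_ (fun j => ?_) j <;>
    simp [hT.apply]

/-- Completing the square in `y`. This identity is the reason for the coordinates `(s, β, T)`. -/
lemma dotProduct_schurMatrix_mulVec {s : ℝ} {β : Fin k → ℝ} (hT : T.IsSymm)
    (a : ℝ) (y : Fin k → ℝ) :
    (Fin.cons a y : Fin (k + 1) → ℝ) ⬝ᵥ (schurMatrix s β T *ᵥ (Fin.cons a y : Fin (k + 1) → ℝ)) =
      s * a ^ 2 + (y + a • β) ⬝ᵥ (T *ᵥ (y + a • β)) := by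
  have h0 : (schurMatrix s β T *ᵥ (Fin.cons a y : Fin (k + 1) → ℝ)) 0 =
      (s + β ⬝ᵥ (T *ᵥ β)) * a + (T *ᵥ β) ⬝ᵥ y := by
    simp [schurMatrix, Matrix.mulVec, dotProduct, Fin.sum_univ_succ]
  have h1 : ∀ i, (schurMatrix s β T *ᵥ (Fin.cons a y : Fin (k + 1) → ℝ)) (Fin.succ i) =
      (T *ᵥ β) i * a + (T *ᵥ y) i := by
    intro i
    simp [schurMatrix, Matrix.mulVec, dotProduct, Fin.sum_univ_succ]
  have h2 : y ⬝ᵥ (T *ᵥ β) = β ⬝ᵥ (T *ᵥ y) := by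
    rw [Matrix.dotProduct_mulVec, ← Matrix.mulVec_transpose, hT.eq, dotProduct_comm]
  have h3 : (Fin.cons a y : Fin (k + 1) → ℝ) ⬝ᵥ
      (schurMatrix s β T *ᵥ (Fin.cons a y : Fin (k + 1) → ℝ)) =
      a * ((s + β ⬝ᵥ (T *ᵥ β)) * a + (T *ᵥ β) ⬝ᵥ y) +
        (a * (y ⬝ᵥ (T *ᵥ β)) + y ⬝ᵥ (T *ᵥ y)) := by
    rw [dotProduct, Fin.sum_univ_succ, h0]
    simp only [h1, Fin.cons_zero, Fin.cons_succ, mul_add, Finset.sum_add_distrib]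
    simp only [dotProduct, Finset.mul_sum]
    congr 2
    refine Finset.sum_congr rfl fun i _ => by ring
  rw [h3, dotProduct_comm (T *ᵥ β) y]
  simp only [Matrix.mulVec_add, Matrix.mulVec_smul, dotProduct_add, add_dotProduct,
    dotProduct_smul, smul_dotProduct, smul_eq_mul, h2]
  ring

/-- In the completed square the two summands can be tested separately, with the vectors `(1, -β)`
and `(0, y)`. The positive definite cone thus becomes a product in the coordinates `(s, β, T)`. -/
lemma posDef_schurMatrix_iff {s : ℝ} {β : Fin k → ℝ} (hT : T.IsSymm) :
    (schurMatrix s β T).PosDef ↔ 0 < s ∧ T.PosDef := by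
  have hsymm : (schurMatrix s β T).IsHermitian := by
    rw [Matrix.IsHermitian, Matrix.conjTranspose_eq_transpose_of_trivial]
    exact isSymm_bordered hT
  have hTh : T.IsHermitian := by
    rw [Matrix.IsHermitian, Matrix.conjTranspose_eq_transpose_of_trivial]
    exact hT
  rw [Matrix.posDef_iff_dotProduct_mulVec, Matrix.posDef_iff_dotProduct_mulVec]
  constructor
  · rintro ⟨-, h⟩
    refine ⟨?_, hTh, fun {y} hy => ?_⟩
    · have := @h (Fin.cons 1 (-β)) (fun h0 => by simpa using congrFun h0 0)
      rw [star_trivial, dotProduct_schurMatrix_mulVec hT] at this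
      simpa using this
    · have := @h (Fin.cons 0 y) (fun h0 => hy (by
        ext i; simpa using congrFun h0 i.succ))
      rw [star_trivial, dotProduct_schurMatrix_mulVec hT] at this
      simpa using this
  · rintro ⟨hs, -, h⟩
    refine ⟨hsymm, fun {x} hx => ?_⟩
    rw [star_trivial, ← Fin.cons_self_tail x, dotProduct_schurMatrix_mulVec hT]
    by_cases h0 : x 0 = 0
    · have hy : Fin.tail x ≠ 0 := by
        rintro hy
        apply hx
        rw [← Fin.cons_self_tail x, hy, h0]
        ext i
        refine Fin.cases rfl (fun i => rfl) i
      have := h hy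
      simpa [h0] using this
    · have h1 : 0 < s * x 0 ^ 2 := by positivity
      have h2 : 0 ≤ (Fin.tail x + x 0 • β) ⬝ᵥ (T *ᵥ (Fin.tail x + x 0 • β)) := by
        by_cases hy : Fin.tail x + x 0 • β = 0
        · simp [hy]
        · simpa using (h hy).le
      linarith

lemma posDef_of_posDef_bordered (h : (bordered c b T).PosDef) : T.PosDef := by
  exact h.submatrix (Fin.succ_injective k)

lemma schurMatrix_mul_inv {s : ℝ} {β : Fin k → ℝ} (hs : s ≠ 0) (hT : T.IsSymm)
    (hdet : IsUnit T.det) :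
    schurMatrix s β T * bordered s⁻¹ (-(s⁻¹ • β)) (T⁻¹ + s⁻¹ • vecMulVec β β) = 1 := by
  have hTT : T * T⁻¹ = 1 := Matrix.mul_nonsing_inv T hdet
  have hTi : ∀ i j, ∑ l, T i l * T⁻¹ l j = (1 : Matrix (Fin k) (Fin k) ℝ) i j := fun i j => by
    rw [← hTT, Matrix.mul_apply]
  have hβT : ∀ j, ∑ l, (T *ᵥ β) l * T⁻¹ l j = β j := fun j => by
    have : (T *ᵥ β) ᵥ* T⁻¹ = β := by
      rw [← Matrix.vecMul_transpose, hT.eq, Matrix.vecMul_vecMul, hTT, Matrix.vecMul_one]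
    exact congrFun this j
  ext i j
  rw [Matrix.mul_apply, Fin.sum_univ_succ]
  refine Fin.cases ?_ (fun i => ?_) i <;> refine Fin.cases ?_ (fun j => ?_) j
  · have : ∑ l, (T *ᵥ β) l * (s⁻¹ * β l) = s⁻¹ * (β ⬝ᵥ (T *ᵥ β)) := by
      rw [dotProduct, Finset.mul_sum]
      exact Finset.sum_congr rfl fun i _ => by ring
    simp [schurMatrix, this]
    field_simp
    ring
  · have : ∑ l, (T *ᵥ β) l * (s⁻¹ * (β l * β j)) = s⁻¹ * (β ⬝ᵥ (T *ᵥ β)) * β j := by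
      rw [dotProduct, Finset.mul_sum, Finset.sum_mul]
      exact Finset.sum_congr rfl fun i _ => by ring
    simp [schurMatrix, mul_add, Finset.sum_add_distrib, hβT, vecMulVec_apply, this,
      (Fin.succ_ne_zero j).symm]
    field_simp
    ring
  · have : ∑ l, T i l * (s⁻¹ * β l) = s⁻¹ * (T *ᵥ β) i := by
      rw [Matrix.mulVec, dotProduct, Finset.mul_sum]
      exact Finset.sum_congr rfl fun i _ => by ring
    simp [schurMatrix, this]
    ring
  · have : ∑ l, T i l * (s⁻¹ * (β l * β j)) = s⁻¹ * (T *ᵥ β) i * β j := by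
      rw [Matrix.mulVec, dotProduct, Finset.mul_sum, Finset.sum_mul]
      exact Finset.sum_congr rfl fun i _ => by ring
    simp [schurMatrix, mul_add, Finset.sum_add_distrib, hTi, vecMulVec_apply, this,
      Matrix.one_apply]
    ring

lemma schurMatrix_inv {s : ℝ} {β : Fin k → ℝ} (hs : s ≠ 0) (hT : T.IsSymm)
    (hdet : IsUnit T.det) :
    (schurMatrix s β T)⁻¹ = bordered s⁻¹ (-(s⁻¹ • β)) (T⁻¹ + s⁻¹ • vecMulVec β β) :=
  Matrix.inv_eq_right_inv (schurMatrix_mul_inv hs hT hdet)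

lemma trace_schurMatrix_inv {s : ℝ} {β : Fin k → ℝ} (hs : s ≠ 0) (hT : T.IsSymm)
    (hdet : IsUnit T.det) :
    (schurMatrix s β T)⁻¹.trace = (T⁻¹).trace + s⁻¹ * (1 + β ⬝ᵥ β) := by
  rw [schurMatrix_inv hs hT hdet, Matrix.trace, Fin.sum_univ_succ]
  simp only [diag_apply, bordered_zero_zero, bordered_succ_succ, Matrix.add_apply,
    Matrix.smul_apply, vecMulVec_apply, smul_eq_mul, Finset.sum_add_distrib, Matrix.trace,
    dotProduct, ← Finset.mul_sum]
  ring

lemma schurMatrix_inv_mulVec_single {s : ℝ} {β : Fin k → ℝ} (hs : s ≠ 0) (hT : T.IsSymm)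
    (hdet : IsUnit T.det) :
    (schurMatrix s β T)⁻¹ *ᵥ Pi.single 0 1 = s⁻¹ • (Fin.cons 1 (-β) : Fin (k + 1) → ℝ) := by
  rw [schurMatrix_inv hs hT hdet, Matrix.mulVec_single_one]
  ext i
  refine Fin.cases ?_ (fun i => ?_) i <;> simp [Matrix.col_apply]

lemma det_schurMatrix {s : ℝ} {β : Fin k → ℝ} (hT : T.IsSymm) :
    (schurMatrix s β T).det = s * T.det := by
  -- Block factorization `[[1, βᵀ], [0, I]] * [[s, 0], [Tβ, T]]`.
  have h1 : (schurMatrix s β T) =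
      (Matrix.of (Fin.cons (Fin.cons 1 β) fun i => Fin.cons 0 ((1 : Matrix _ _ ℝ) i)) :
        Matrix (Fin (k + 1)) (Fin (k + 1)) ℝ) *
      (Matrix.of (Fin.cons (Fin.cons s 0) fun i => Fin.cons ((T *ᵥ β) i) (T i))) := by
    ext i j
    rw [Matrix.mul_apply, Fin.sum_univ_succ]
    refine Fin.cases ?_ (fun i => ?_) i <;> refine Fin.cases ?_ (fun j => ?_) j
    · simp [schurMatrix, dotProduct]
    · have : ∑ l, β l * T l j = (T *ᵥ β) j := by
        simp [Matrix.mulVec, dotProduct, hT.apply, mul_comm]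
      simp [schurMatrix, this]
    · simp [schurMatrix, Matrix.one_apply]
    · simp [schurMatrix, Matrix.one_apply]
  rw [h1, Matrix.det_mul]
  have h2 : (Matrix.of (Fin.cons (Fin.cons 1 β) fun i => Fin.cons 0 ((1 : Matrix _ _ ℝ) i)) :
        Matrix (Fin (k + 1)) (Fin (k + 1)) ℝ).det = 1 := by
    rw [Matrix.det_succ_column_zero, Fin.sum_univ_succ]
    have : (Matrix.of (Fin.cons (Fin.cons 1 β) fun i => Fin.cons 0 ((1 : Matrix _ _ ℝ) i)) :
        Matrix (Fin (k + 1)) (Fin (k + 1)) ℝ).submatrix Fin.succ Fin.succ = 1 := by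
      ext i j; simp
    simp [this]
  have h3 : (Matrix.of (Fin.cons (Fin.cons s 0) fun i => Fin.cons ((T *ᵥ β) i) (T i)) :
        Matrix (Fin (k + 1)) (Fin (k + 1)) ℝ).det = s * T.det := by
    rw [Matrix.det_succ_row_zero, Fin.sum_univ_succ]
    have : (Matrix.of (Fin.cons (Fin.cons s 0) fun i => Fin.cons ((T *ᵥ β) i) (T i)) :
        Matrix (Fin (k + 1)) (Fin (k + 1)) ℝ).submatrix Fin.succ Fin.succ = T := by
      ext i j; simp
    simp [this]
  rw [h2, h3, one_mul]

end bordered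

/-! ### Measurability of matrix operations -/

instance matrixBorelSpace {m n : ℕ} : BorelSpace (Matrix (Fin m) (Fin n) ℝ) :=
  inferInstanceAs (BorelSpace (Fin m → Fin n → ℝ))

instance matrixPolishSpace {m n : ℕ} : PolishSpace (Matrix (Fin m) (Fin n) ℝ) :=
  inferInstanceAs (PolishSpace (Fin m → Fin n → ℝ))

lemma isClosed_setOf_posSemidef (k : ℕ) :
    IsClosed {S : Matrix (Fin k) (Fin k) ℝ | S.PosSemidef} := by
  simp only [Matrix.posSemidef_iff_dotProduct_mulVec, Matrix.IsHermitian, Set.ofPred_and,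
    Set.ofPred_forall]
  refine IsClosed.inter (isClosed_eq (by fun_prop) continuous_id) ?_
  refine isClosed_iInter fun x => isClosed_le continuous_const ?_
  fun_prop

/-- Positive definite means positive semidefinite, a closed condition, with nonzero determinant, an
open one. -/
lemma measurableSet_posDef (k : ℕ) :
    MeasurableSet {S : Matrix (Fin k) (Fin k) ℝ | S.PosDef} := by
  have : {S : Matrix (Fin k) (Fin k) ℝ | S.PosDef} =
      {S | S.PosSemidef} ∩ {S | S.det = 0}ᶜ := by
    ext S
    constructor
    · intro h
      exact ⟨h.posSemidef, h.det_pos.ne'⟩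
    · rintro ⟨h1, h2⟩
      exact h1.posDef_iff_det_ne_zero.2 h2
  rw [this]
  refine (isClosed_setOf_posSemidef k).measurableSet.inter (IsClosed.measurableSet ?_).compl
  exact isClosed_eq (by fun_prop) continuous_const

lemma measurable_matrix_inv (k : ℕ) :
    Measurable fun S : Matrix (Fin k) (Fin k) ℝ => S⁻¹ := by
  have : (fun S : Matrix (Fin k) (Fin k) ℝ => S⁻¹) = fun S => S.det⁻¹ • S.adjugate := by
    ext S
    rw [Matrix.inv_def, Ring.inverse_eq_inv']
  rw [this]
  have h1 : Measurable fun S : Matrix (Fin k) (Fin k) ℝ => S.det⁻¹ :=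
    (Continuous.measurable (by fun_prop)).inv
  have h2 : Measurable fun S : Matrix (Fin k) (Fin k) ℝ => S.adjugate :=
    Continuous.measurable (by fun_prop)
  have h3 : Continuous fun q : ℝ × Matrix (Fin k) (Fin k) ℝ => q.1 • q.2 := by fun_prop
  exact h3.measurable.comp (h1.prodMk h2)

lemma measurable_symMatrix (k : ℕ) : Measurable (symMatrix (k := k)) :=
  measurable_pi_iff.2 fun _ => measurable_pi_iff.2 fun _ => measurable_pi_apply _

lemma isSymm_symMatrix {k : ℕ} (u : {q : Fin k × Fin k // q.1 ≤ q.2} → ℝ) :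
    (symMatrix u).IsSymm := by
  ext i j
  simp [symMatrix, min_comm, max_comm]

/-- Lebesgue measure on positive definite matrices. -/
def posDefVolume (k : ℕ) : Measure (Matrix (Fin k) (Fin k) ℝ) :=
  ((volume : Measure ({q : Fin k × Fin k // q.1 ≤ q.2} → ℝ)).map symMatrix).restrict
      {S | S.PosDef}

instance sFinite_posDefVolume (k : ℕ) : SFinite (posDefVolume k) := by
  unfold posDefVolume
  infer_instance

lemma lintegral_posDefVolume {k : ℕ} {F : Matrix (Fin k) (Fin k) ℝ → ℝ≥0∞} (hF : Measurable F) :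
    ∫⁻ S, F S ∂posDefVolume k =
      ∫⁻ u : {q : Fin k × Fin k // q.1 ≤ q.2} → ℝ, {S | S.PosDef}.indicator F (symMatrix u) := by
  rw [posDefVolume, ← lintegral_indicator (measurableSet_posDef k),
    lintegral_map (hF.indicator (measurableSet_posDef k)) (measurable_symMatrix k)]

lemma ae_posDef_posDefVolume (k : ℕ) : ∀ᵐ S ∂posDefVolume k, S.PosDef :=
  ae_restrict_mem (measurableSet_posDef k)

/-! ### Splitting off the first row and column -/

/-- A position on or above the diagonal lies in the first row or in the remaining block. -/
def upperIndexEquiv (k : ℕ) :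
    {q : Fin k × Fin k // q.1 ≤ q.2} ⊕ Fin (k + 1) ≃
      {q : Fin (k + 1) × Fin (k + 1) // q.1 ≤ q.2} :=
  Equiv.ofBijective
    (Sum.elim (fun q => ⟨(q.1.1.succ, q.1.2.succ), Fin.succ_le_succ_iff.2 q.2⟩)
      fun j => ⟨(0, j), Fin.zero_le j⟩) <| by
    constructor
    · rintro (⟨⟨i, j⟩, h⟩ | j) (⟨⟨i', j'⟩, h'⟩ | j') hq
      · simpa using hq
      · simp at hq
      · simp [(Fin.succ_ne_zero _).symm] at hq
      · simpa using hq
    · rintro ⟨⟨i, j⟩, h⟩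
      induction i using Fin.cases with
      | zero => exact ⟨Sum.inr j, rfl⟩
      | succ i =>
        induction j using Fin.cases with
        | zero => exact absurd h (by simp)
        | succ j => exact ⟨Sum.inl ⟨(i, j), Fin.succ_le_succ_iff.1 h⟩, rfl⟩

@[simp] lemma upperIndexEquiv_inl {k : ℕ} (q : {q : Fin k × Fin k // q.1 ≤ q.2}) :
    upperIndexEquiv k (Sum.inl q) =
      ⟨(q.1.1.succ, q.1.2.succ), Fin.succ_le_succ_iff.2 q.2⟩ := rfl

@[simp] lemma upperIndexEquiv_inr {k : ℕ} (j : Fin (k + 1)) :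
    upperIndexEquiv k (Sum.inr j) = ⟨(0, j), Fin.zero_le j⟩ := rfl

lemma symMatrix_upperIndexEquiv {k : ℕ} (u : {q : Fin (k + 1) × Fin (k + 1) // q.1 ≤ q.2} → ℝ) :
    symMatrix u = bordered (u (upperIndexEquiv k (Sum.inr 0)))
      (fun j => u (upperIndexEquiv k (Sum.inr j.succ)))
      (symMatrix fun q => u (upperIndexEquiv k (Sum.inl q))) := by
  ext i j
  refine Fin.cases ?_ (fun i => ?_) i <;> refine Fin.cases ?_ (fun j => ?_) j
  · rfl
  · simp [symMatrix]
  · simp [symMatrix]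
  · have h1 : min i.succ j.succ = (min i j).succ := (Fin.strictMono_succ.monotone.map_min).symm
    have h2 : max i.succ j.succ = (max i j).succ := (Fin.strictMono_succ.monotone.map_max).symm
    simp [symMatrix, h1, h2]

lemma measurable_bordered {k : ℕ} :
    Measurable fun q : Matrix (Fin k) (Fin k) ℝ × (Fin k → ℝ) × ℝ => bordered q.2.2 q.2.1 q.1 := by
  refine measurable_pi_iff.2 fun i => measurable_pi_iff.2 fun j => ?_
  refine Fin.cases ?_ (fun i => ?_) i <;> refine Fin.cases ?_ (fun j => ?_) j
  · exact measurable_snd.comp measurable_snd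
  · exact (measurable_pi_apply j).comp (measurable_fst.comp measurable_snd)
  · exact (measurable_pi_apply i).comp (measurable_fst.comp measurable_snd)
  · exact (measurable_pi_apply j).comp ((measurable_pi_apply i).comp measurable_fst)

/-- The entries on and above the diagonal are permuted into the lower block, the rest of the first
row and the corner; permutations of coordinates and Tonelli preserve the integral. -/
lemma lintegral_symMatrix_succ {k : ℕ} {F : Matrix (Fin (k + 1)) (Fin (k + 1)) ℝ → ℝ≥0∞}
    (hF : Measurable F) :
    ∫⁻ u : {q : Fin (k + 1) × Fin (k + 1) // q.1 ≤ q.2} → ℝ, F (symMatrix u) =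
      ∫⁻ u : {q : Fin k × Fin k // q.1 ≤ q.2} → ℝ, ∫⁻ b : Fin k → ℝ, ∫⁻ c : ℝ,
        F (bordered c b (symMatrix u)) := by
  have e1 := (volume_measurePreserving_piCongrLeft (fun _ => ℝ) (upperIndexEquiv k)).symm
  have e2 := volume_measurePreserving_sumPiEquivProdPi
    (fun _ : {q : Fin k × Fin k // q.1 ≤ q.2} ⊕ Fin (k + 1) => ℝ)
  have e3 := volume_preserving_piFinSuccAbove (fun _ : Fin (k + 1) => ℝ) 0
  have hB : Measurable fun q : ({q : Fin k × Fin k // q.1 ≤ q.2} → ℝ) × (ℝ × (Fin k → ℝ)) =>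
      F (bordered q.2.1 q.2.2 (symMatrix q.1)) :=
    hF.comp (measurable_bordered.comp (((measurable_symMatrix k).comp measurable_fst).prodMk
      ((measurable_snd.comp measurable_snd).prodMk (measurable_fst.comp measurable_snd))))
  have e := (MeasurePreserving.prod (MeasurePreserving.id volume) e3).comp (e2.comp e1)
  calc _ = ∫⁻ u : {q : Fin (k + 1) × Fin (k + 1) // q.1 ≤ q.2} → ℝ,
        F (bordered (u (upperIndexEquiv k (Sum.inr 0)))
          (fun j => u (upperIndexEquiv k (Sum.inr j.succ)))
          (symMatrix fun q => u (upperIndexEquiv k (Sum.inl q)))) := by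
        simp only [← symMatrix_upperIndexEquiv]
    _ = ∫⁻ q : ({q : Fin k × Fin k // q.1 ≤ q.2} → ℝ) × (ℝ × (Fin k → ℝ)),
        F (bordered q.2.1 q.2.2 (symMatrix q.1)) := by
        rw [Measure.volume_eq_prod, ← e.lintegral_comp hB]
        rfl
    _ = _ := by
        rw [Measure.volume_eq_prod, lintegral_prod _ hB.aemeasurable]
        refine lintegral_congr fun u => ?_
        have hu : Measurable fun q : ℝ × (Fin k → ℝ) =>
          F (bordered q.1 q.2 (symMatrix u)) := hB.comp measurable_prodMk_left
        rw [Measure.volume_eq_prod, lintegral_prod_symm _ hu.aemeasurable]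

lemma lintegral_mulVec {k : ℕ} {A : Matrix (Fin k) (Fin k) ℝ} (hA : A.det ≠ 0)
    {F : (Fin k → ℝ) → ℝ≥0∞} (hF : Measurable F) :
    ∫⁻ y, F y = ENNReal.ofReal |A.det| * ∫⁻ y, F (A *ᵥ y) := by
  have h := Real.map_matrix_volume_pi_eq_smul_volume_pi hA
  have hm : Measurable (Matrix.toLin' A) := by
    have : Continuous (fun y => A *ᵥ y) := by fun_prop
    exact this.measurable
  have h2 : ∫⁻ y, F (A *ᵥ y) = ∫⁻ y, F y ∂(Measure.map (Matrix.toLin' A) volume) := by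
    rw [lintegral_map hF hm]; rfl
  rw [h2, h, lintegral_smul_measure, smul_eq_mul, ← mul_assoc, ← ENNReal.ofReal_mul (abs_nonneg _),
    ← abs_mul, mul_inv_cancel₀ hA]
  simp

/-- Change of variables from the bordered entries `(c, b, T)` to `(s, β, T)`: the substitution `b =
T β` has Jacobian `det T`, and `c = s + βᵀ T β` is a translation for fixed `β` and `T`. -/
lemma lintegral_posDefVolume_succ {k : ℕ} {F : Matrix (Fin (k + 1)) (Fin (k + 1)) ℝ → ℝ≥0∞}
    (hF : Measurable F) :
    ∫⁻ S, F S ∂posDefVolume (k + 1) =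
      ∫⁻ T, (ENNReal.ofReal T.det * ∫⁻ β : Fin k → ℝ, ∫⁻ s in Set.Ioi (0 : ℝ),
        F (schurMatrix s β T)) ∂posDefVolume k := by
  have hG := hF.indicator (measurableSet_posDef (k + 1))
  have hschur : Measurable fun q : (Matrix (Fin k) (Fin k) ℝ × (Fin k → ℝ)) × ℝ =>
      F (schurMatrix q.2 q.1.2 q.1.1) := by
    refine hF.comp (measurable_bordered.comp (measurable_fst.fst.prodMk (Measurable.prodMk ?_ ?_)))
    · have : Continuous fun q : (Matrix (Fin k) (Fin k) ℝ × (Fin k → ℝ)) × ℝ => q.1.1 *ᵥ q.1.2 := by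
        fun_prop
      exact this.measurable
    · have : Continuous fun q : (Matrix (Fin k) (Fin k) ℝ × (Fin k → ℝ)) × ℝ =>
        q.2 + q.1.2 ⬝ᵥ (q.1.1 *ᵥ q.1.2) := by fun_prop
      exact this.measurable
  have hdet : Measurable fun T : Matrix (Fin k) (Fin k) ℝ => ENNReal.ofReal T.det :=
    (Continuous.measurable (by fun_prop)).ennreal_ofReal
  have hI : Measurable fun T : Matrix (Fin k) (Fin k) ℝ => ENNReal.ofReal T.det *
      ∫⁻ β : Fin k → ℝ, ∫⁻ s in Set.Ioi (0 : ℝ), F (schurMatrix s β T) :=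
    hdet.mul hschur.lintegral_prod_right'.lintegral_prod_right'
  rw [lintegral_posDefVolume hF, lintegral_symMatrix_succ hG, lintegral_posDefVolume hI]
  refine lintegral_congr fun u => ?_
  by_cases hT : (symMatrix u).PosDef
  · rw [Set.indicator_of_mem (by exact hT)]
    set T := symMatrix u with hTdef
    have hsymm : T.IsSymm := isSymm_symMatrix u
    have hB : Measurable fun q : (Fin k → ℝ) × ℝ =>
        {S | S.PosDef}.indicator F (bordered q.2 q.1 T) :=
      hG.comp (measurable_bordered.comp (measurable_const.prodMk measurable_id))
    rw [lintegral_mulVec hT.det_pos.ne' hB.lintegral_prod_right', abs_of_pos hT.det_pos]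
    congr 1
    refine lintegral_congr fun β => ?_
    rw [← lintegral_add_right_eq_self _ (β ⬝ᵥ (T *ᵥ β)), ← lintegral_indicator measurableSet_Ioi]
    refine lintegral_congr fun s => ?_
    have := posDef_schurMatrix_iff (s := s) (β := β) hsymm
    by_cases hs : 0 < s
    · rw [Set.indicator_of_mem (by exact this.2 ⟨hs, hT⟩), Set.indicator_of_mem (by exact hs)]
      rfl
    · rw [Set.indicator_of_notMem (by exact fun h => hs (this.1 h).1),
        Set.indicator_of_notMem (by exact hs)]
  · rw [Set.indicator_of_notMem (by exact hT)]
    have : ∀ b c, {S | S.PosDef}.indicator F (bordered c b (symMatrix u)) = 0 := by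
      intro b c
      rw [Set.indicator_of_notMem]
      exact fun h => hT (posDef_of_posDef_bordered h)
    simp [this]

/-! ### The congruence action on symmetric matrices -/

lemma symMatrix_add {k : ℕ} (u w : {q : Fin k × Fin k // q.1 ≤ q.2} → ℝ) :
    symMatrix (u + w) = symMatrix u + symMatrix w := rfl

lemma symMatrix_smul {k : ℕ} (a : ℝ) (u : {q : Fin k × Fin k // q.1 ≤ q.2} → ℝ) :
    symMatrix (a • u) = a • symMatrix u := rfl

/-- The linear map `T ↦ A T Aᵀ` in the coordinates on and above the diagonal. -/
def congrMap {k : ℕ} (A : Matrix (Fin k) (Fin k) ℝ) :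
    ({q : Fin k × Fin k // q.1 ≤ q.2} → ℝ) →ₗ[ℝ] ({q : Fin k × Fin k // q.1 ≤ q.2} → ℝ) where
  toFun u := fun q => (A * symMatrix u * Aᵀ) q.1.1 q.1.2
  map_add' u w := by
    ext q
    simp [symMatrix_add, Matrix.mul_add, Matrix.add_mul]
  map_smul' a u := by
    ext q
    simp [symMatrix_smul]

lemma congrMap_apply {k : ℕ} (A : Matrix (Fin k) (Fin k) ℝ)
    (u : {q : Fin k × Fin k // q.1 ≤ q.2} → ℝ) (q : {q : Fin k × Fin k // q.1 ≤ q.2}) :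
    congrMap A u q = (A * symMatrix u * Aᵀ) q.1.1 q.1.2 := rfl

lemma symMatrix_congrMap {k : ℕ} (A : Matrix (Fin k) (Fin k) ℝ)
    (u : {q : Fin k × Fin k // q.1 ≤ q.2} → ℝ) :
    symMatrix (congrMap A u) = A * symMatrix u * Aᵀ := by
  have hs : (A * symMatrix u * Aᵀ).IsSymm := by
    rw [Matrix.IsSymm, Matrix.transpose_mul, Matrix.transpose_mul, Matrix.transpose_transpose,
      (isSymm_symMatrix u).eq, Matrix.mul_assoc]
  ext i j
  rw [symMatrix, Matrix.of_apply, congrMap_apply]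
  rcases le_total i j with h | h
  · simp only [min_eq_left h, max_eq_right h]
  · simp only [min_eq_right h, max_eq_left h]
    exact hs.apply _ _

lemma congrMap_mul {k : ℕ} (A B : Matrix (Fin k) (Fin k) ℝ) :
    congrMap (A * B) = congrMap A ∘ₗ congrMap B := by
  ext1 u
  ext q
  simp only [LinearMap.comp_apply, congrMap_apply, symMatrix_congrMap, Matrix.transpose_mul,
    Matrix.mul_assoc]

lemma symMatrix_upper {k : ℕ} (u : {q : Fin k × Fin k // q.1 ≤ q.2} → ℝ)
    (q : {q : Fin k × Fin k // q.1 ≤ q.2}) : symMatrix u q.1.1 q.1.2 = u q := by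
  rw [symMatrix, Matrix.of_apply]
  congr 1
  ext1
  simp [min_eq_left q.2, max_eq_right q.2]

lemma congrMap_one {k : ℕ} : congrMap (1 : Matrix (Fin k) (Fin k) ℝ) = LinearMap.id := by
  ext1 u
  ext q
  simp [congrMap_apply, symMatrix_upper]

/-- Index `i` is the row of `k - i` pairs and the column of `i + 1` pairs, hence occurs `k + 1`
times in all. -/
lemma prod_upper {k : ℕ} (D : Fin k → ℝ) :
    ∏ q : {q : Fin k × Fin k // q.1 ≤ q.2}, D q.1.1 * D q.1.2 = (∏ i, D i) ^ (k + 1) := by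
  have h := Finset.prod_subtype (F := inferInstance)
    (Finset.univ.filter fun q : Fin k × Fin k => q.1 ≤ q.2) (p := fun q => q.1 ≤ q.2) (by simp)
    (fun q => D q.1 * D q.2)
  rw [← h, Finset.prod_filter, ← Finset.univ_product_univ, Finset.prod_product]
  have h1 : ∀ i j : Fin k, (if i ≤ j then D i * D j else 1) =
      (if i ≤ j then D i else 1) * (if i ≤ j then D j else 1) := by
    intro i j; split_ifs <;> simp
  simp only [h1, Finset.prod_mul_distrib]
  rw [Finset.prod_comm (f := fun i j => if i ≤ j then D j else 1), ← Finset.prod_mul_distrib,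
    ← Finset.prod_pow]
  refine Finset.prod_congr rfl fun i _ => ?_
  rw [Finset.prod_ite, Finset.prod_ite]
  simp only [Finset.prod_const, one_pow, mul_one]
  rw [← pow_add]
  congr 1
  rw [Finset.filter_le_eq_Ici, Finset.filter_ge_eq_Iic, Fin.card_Ici, Fin.card_Iic]
  omega

lemma det_congrMap_diagonal {k : ℕ} (D : Fin k → ℝ) :
    LinearMap.det (congrMap (Matrix.diagonal D)) = (Matrix.diagonal D).det ^ (k + 1) := by
  have : congrMap (Matrix.diagonal D) =
      Matrix.toLin' (Matrix.diagonal fun q : {q : Fin k × Fin k // q.1 ≤ q.2} =>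
        D q.1.1 * D q.1.2) := by
    refine LinearMap.ext fun u => funext fun q => ?_
    rw [congrMap_apply, Matrix.toLin'_apply, Matrix.mulVec_diagonal, Matrix.diagonal_transpose,
      Matrix.mul_diagonal, Matrix.diagonal_mul, symMatrix_upper]
    ring
  rw [this, LinearMap.det_toLin', Matrix.det_diagonal, Matrix.det_diagonal, prod_upper]

lemma det_congrMap_mul {k : ℕ} (A B : Matrix (Fin k) (Fin k) ℝ) :
    LinearMap.det (congrMap (A * B)) = LinearMap.det (congrMap A) * LinearMap.det (congrMap B) := by
  rw [congrMap_mul, LinearMap.det_comp]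

/-- Conjugation by a diagonal matrix turns the parameter `a` into `2 * a`, so both transvections
give the same determinant `δ`. But the second is the square of the first, so `δ = δ²`, and `δ` is
invertible. -/
lemma det_congrMap_transvection {k : ℕ} {i j : Fin k} (hij : i ≠ j) (a : ℝ) :
    LinearMap.det (congrMap (Matrix.transvection i j a)) = 1 := by
  set D : Fin k → ℝ := fun l => if l = i then 2 else 1 with hD
  have hDne : (Matrix.diagonal D).det ≠ 0 := by
    rw [Matrix.det_diagonal, Finset.prod_ne_zero_iff]
    intro l _
    simp only [hD]; split_ifs <;> norm_num
  have h1 : Matrix.diagonal D * Matrix.transvection i j a =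
      Matrix.transvection i j (2 * a) * Matrix.diagonal D := by
    ext l m
    rw [Matrix.diagonal_mul, Matrix.mul_diagonal]
    simp only [Matrix.transvection, Matrix.add_apply, Matrix.one_apply, Matrix.single_apply, hD]
    by_cases hl : l = i
    · subst hl
      by_cases hm : m = l
      · subst hm; simp [hij.symm]
      · by_cases hmj : j = m
        · subst hmj; simp [hij, hij.symm]
        · simp [hm, hmj, Ne.symm hm]
    · by_cases hm : m = l
      · subst hm; simp [hl, Ne.symm hl]
      · simp [hl, Ne.symm hl, Ne.symm hm]
  have h2 := congrArg (fun M => LinearMap.det (congrMap M)) h1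
  simp only [det_congrMap_mul, det_congrMap_diagonal] at h2
  have h3 : LinearMap.det (congrMap (Matrix.transvection i j (2 * a))) =
      LinearMap.det (congrMap (Matrix.transvection i j a)) ^ 2 := by
    rw [two_mul, ← Matrix.transvection_mul_transvection_same _ _ hij, det_congrMap_mul, sq]
  have h4 : LinearMap.det (congrMap (Matrix.transvection i j a)) *
      LinearMap.det (congrMap (Matrix.transvection i j (-a))) = 1 := by
    rw [← det_congrMap_mul, Matrix.transvection_mul_transvection_same _ _ hij, add_neg_cancel,
      Matrix.transvection_zero, congrMap_one, LinearMap.det_id]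
  have h5 := left_ne_zero_of_mul_eq_one h4
  have h6 : (Matrix.diagonal D).det ^ (k + 1) ≠ 0 := pow_ne_zero _ hDne
  rw [h3, mul_comm] at h2
  have h7 := mul_right_cancel₀ h6 h2
  rw [sq] at h7
  exact (mul_eq_left₀ h5).1 h7.symm

/-- The Jacobian of `T ↦ A T Aᵀ` on symmetric matrices. -/
lemma det_congrMap {k : ℕ} {A : Matrix (Fin k) (Fin k) ℝ} (hA : A.det ≠ 0) :
    LinearMap.det (congrMap A) = A.det ^ (k + 1) := by
  refine Matrix.diagonal_transvection_induction_of_det_ne_zero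
    (fun A => LinearMap.det (congrMap A) = A.det ^ (k + 1)) A hA
    (fun D _ => det_congrMap_diagonal D) (fun t => ?_) (fun A B _ _ h1 h2 => ?_)
  · rw [Matrix.TransvectionStruct.toMatrix, det_congrMap_transvection t.hij,
      Matrix.det_transvection_of_ne _ _ t.hij, one_pow]
  · rw [det_congrMap_mul, h1, h2, Matrix.det_mul, mul_pow]

lemma posDef_congr_iff {k : ℕ} {A T : Matrix (Fin k) (Fin k) ℝ} (hA : A.det ≠ 0) :
    (A * T * Aᵀ).PosDef ↔ T.PosDef := by
  have hu : IsUnit A := (Matrix.isUnit_iff_isUnit_det A).2 hA.isUnit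
  have := Matrix.IsUnit.posDef_star_right_conjugate_iff hu (x := T)
  rwa [Matrix.star_eq_conjTranspose, Matrix.conjTranspose_eq_transpose_of_trivial] at this

/-- Linear change of variables with the Jacobian `det_congrMap`; congruence by an invertible matrix
maps the positive definite cone onto itself. -/
lemma lintegral_posDefVolume_congr {k : ℕ} {A : Matrix (Fin k) (Fin k) ℝ} (hA : A.det ≠ 0)
    {F : Matrix (Fin k) (Fin k) ℝ → ℝ≥0∞} (hF : Measurable F) :
    ∫⁻ S, F S ∂posDefVolume k =
      ENNReal.ofReal (|A.det| ^ (k + 1)) * ∫⁻ T, F (A * T * Aᵀ) ∂posDefVolume k := by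
  have hA' : LinearMap.det (congrMap A) ≠ 0 := by
    rw [det_congrMap hA]; exact pow_ne_zero _ hA
  have hcont : Continuous fun T : Matrix (Fin k) (Fin k) ℝ => A * T * Aᵀ := by fun_prop
  have hG := hF.indicator (measurableSet_posDef k)
  rw [lintegral_posDefVolume hF,
    lintegral_posDefVolume (F := fun T => F (A * T * Aᵀ)) (hF.comp hcont.measurable)]
  have hmap := Measure.map_linearMap_addHaar_eq_smul_addHaar
    (volume : Measure ({q : Fin k × Fin k // q.1 ≤ q.2} → ℝ)) hA'
  have h2 : ∫⁻ u : {q : Fin k × Fin k // q.1 ≤ q.2} → ℝ,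
      {S | S.PosDef}.indicator (fun T => F (A * T * Aᵀ)) (symMatrix u) =
      ∫⁻ u, {S | S.PosDef}.indicator F (symMatrix u)
        ∂(Measure.map (congrMap A)
          (volume : Measure ({q : Fin k × Fin k // q.1 ≤ q.2} → ℝ))) := by
    rw [lintegral_map (f := fun u => {S : Matrix (Fin k) (Fin k) ℝ | S.PosDef}.indicator F
      (symMatrix u)) (hG.comp (measurable_symMatrix k))
      (LinearMap.continuous_of_finiteDimensional _).measurable]
    refine lintegral_congr fun u => ?_
    rw [symMatrix_congrMap]
    by_cases h : (symMatrix u).PosDef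
    · rw [Set.indicator_of_mem (by exact h),
        Set.indicator_of_mem (by exact (posDef_congr_iff hA).2 h)]
    · rw [Set.indicator_of_notMem (by exact h),
        Set.indicator_of_notMem (by exact fun h' => h ((posDef_congr_iff hA).1 h'))]
  rw [h2, hmap, lintegral_smul_measure, smul_eq_mul, ← mul_assoc, det_congrMap hA,
    ← ENNReal.ofReal_mul (by positivity), ← abs_pow, ← abs_mul,
    mul_inv_cancel₀ (pow_ne_zero _ hA)]
  simp

/-! ### Gaussian integrals -/

/-- The standard normal distribution on `Fin k → ℝ`. -/
def stdNormal (k : ℕ) : Measure (Fin k → ℝ) := Measure.pi fun _ => gaussianReal 0 1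

instance isProbabilityMeasure_stdNormal (k : ℕ) : IsProbabilityMeasure (stdNormal k) := by
  unfold stdNormal
  infer_instance

lemma lintegral_pi_prod {k : ℕ} {f : Fin k → ℝ → ℝ≥0∞} (hf : ∀ i, Measurable (f i)) :
    ∫⁻ y : Fin k → ℝ, ∏ i, f i (y i) = ∏ i, ∫⁻ t, f i t := by
  induction k with
  | zero => simp [volume_pi]
  | succ k ih =>
    have e := volume_preserving_piFinSuccAbove (fun _ : Fin (k + 1) => ℝ) 0
    have hm : Measurable fun q : ℝ × (Fin k → ℝ) => f 0 q.1 * ∏ i : Fin k, f i.succ (q.2 i) :=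
      ((hf 0).comp measurable_fst).mul (Finset.measurable_prod _ fun i _ =>
        (hf i.succ).comp ((measurable_pi_apply i).comp measurable_snd))
    have h1 : ∫⁻ y : Fin (k + 1) → ℝ, ∏ i, f i (y i) =
        ∫⁻ q : ℝ × (Fin k → ℝ), f 0 q.1 * ∏ i : Fin k, f i.succ (q.2 i) := by
      rw [← e.lintegral_comp hm]
      refine lintegral_congr fun y => ?_
      rw [Fin.prod_univ_succ]
      rfl
    have hm' : Measurable fun y : Fin k → ℝ => ∏ i : Fin k, f i.succ (y i) :=
      Finset.measurable_prod _ fun i _ => (hf i.succ).comp (measurable_pi_apply i)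
    rw [h1, Measure.volume_eq_prod, lintegral_prod_mul (hf 0).aemeasurable hm'.aemeasurable,
      ih fun i => hf i.succ, Fin.prod_univ_succ]

lemma stdNormal_eq_withDensity_prod (k : ℕ) :
    stdNormal k = volume.withDensity fun z : Fin k → ℝ => ∏ i, gaussianPDF 0 1 (z i) := by
  refine Measure.pi_eq fun s hs => ?_
  rw [withDensity_apply _ (MeasurableSet.univ_pi hs),
    ← lintegral_indicator (MeasurableSet.univ_pi hs)]
  have h : ∀ z : Fin k → ℝ, (Set.univ.pi s).indicator
      (fun z : Fin k → ℝ => ∏ i, gaussianPDF 0 1 (z i)) z =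
      ∏ i, (s i).indicator (gaussianPDF 0 1) (z i) := by
    intro z
    by_cases hz : z ∈ Set.univ.pi s
    · rw [Set.indicator_of_mem hz]
      exact Finset.prod_congr rfl fun i _ => by rw [Set.indicator_of_mem (hz i trivial)]
    · rw [Set.indicator_of_notMem hz]
      simp only [Set.mem_univ_pi, not_forall] at hz
      obtain ⟨i, hi⟩ := hz
      exact (Finset.prod_eq_zero (Finset.mem_univ i) (Set.indicator_of_notMem hi _)).symm
  simp only [h]
  rw [lintegral_pi_prod fun i => (measurable_gaussianPDF 0 1).indicator (hs i)]
  refine Finset.prod_congr rfl fun i _ => ?_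
  rw [lintegral_indicator (hs i), gaussianReal_of_var_ne_zero _ one_ne_zero,
    withDensity_apply _ (hs i)]

lemma prod_gaussianPDF {k : ℕ} (z : Fin k → ℝ) :
    ∏ i, gaussianPDF 0 1 (z i) =
      ENNReal.ofReal ((2 * Real.pi) ^ (-(k : ℝ) / 2) * Real.exp (-(z ⬝ᵥ z) / 2)) := by
  simp only [gaussianPDF]
  rw [← ENNReal.ofReal_prod_of_nonneg fun i _ => gaussianPDFReal_nonneg _ _ _]
  congr 1
  simp only [gaussianPDFReal, Finset.prod_mul_distrib, ← Real.exp_sum, Finset.prod_const,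
    Finset.card_univ, Fintype.card_fin]
  congr 1
  · rw [NNReal.coe_one, mul_one, Real.sqrt_eq_rpow, ← Real.rpow_neg (by positivity),
      ← Real.rpow_natCast, ← Real.rpow_mul (by positivity)]
    congr 1; ring
  · congr 1
    simp only [dotProduct, sub_zero, NNReal.coe_one, mul_one, ← Finset.sum_div,
      Finset.sum_neg_distrib, sq]

lemma lintegral_stdNormal {k : ℕ} {F : (Fin k → ℝ) → ℝ≥0∞} (hF : Measurable F) :
    ∫⁻ z, F z ∂stdNormal k =
      ENNReal.ofReal ((2 * Real.pi) ^ (-(k : ℝ) / 2)) *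
        ∫⁻ z, ENNReal.ofReal (Real.exp (-(z ⬝ᵥ z) / 2)) * F z := by
  have hd : Measurable fun z : Fin k → ℝ => ENNReal.ofReal (Real.exp (-(z ⬝ᵥ z) / 2)) := by
    have : Continuous fun z : Fin k → ℝ => Real.exp (-(z ⬝ᵥ z) / 2) := by fun_prop
    exact this.measurable.ennreal_ofReal
  rw [stdNormal_eq_withDensity_prod, lintegral_withDensity_eq_lintegral_mul _ _ hF,
    ← lintegral_const_mul _ (by exact hd.mul hF)]
  · refine lintegral_congr fun z => ?_
    rw [Pi.mul_apply, prod_gaussianPDF, ENNReal.ofReal_mul (by positivity), mul_assoc]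
  · exact Finset.measurable_prod _ fun i _ =>
      (measurable_gaussianPDF 0 1).comp (measurable_pi_apply i)

lemma lintegral_exp_neg_mul_dotProduct (k : ℕ) {b : ℝ} (hb : 0 < b) :
    ∫⁻ y : Fin k → ℝ, ENNReal.ofReal (Real.exp (-(b * (y ⬝ᵥ y)))) =
      ENNReal.ofReal ((Real.pi / b) ^ ((k : ℝ) / 2)) := by
  have h1 : ∫⁻ t : ℝ, ENNReal.ofReal (Real.exp (-b * t ^ 2)) =
      ENNReal.ofReal (√(Real.pi / b)) := by
    rw [← integral_gaussian, ofReal_integral_eq_lintegral_ofReal (integrable_exp_neg_mul_sq hb)]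
    exact Filter.Eventually.of_forall fun t => (Real.exp_pos _).le
  have h2 : ∀ y : Fin k → ℝ, ENNReal.ofReal (Real.exp (-(b * (y ⬝ᵥ y)))) =
      ∏ i, ENNReal.ofReal (Real.exp (-b * (y i) ^ 2)) := by
    intro y
    rw [← ENNReal.ofReal_prod_of_nonneg fun i _ => (Real.exp_pos _).le, ← Real.exp_sum]
    congr 2
    rw [dotProduct, ← Finset.mul_sum, neg_mul]
    simp only [sq]
  simp only [h2]
  rw [lintegral_pi_prod (f := fun _ t => ENNReal.ofReal (Real.exp (-b * t ^ 2))) fun i =>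
    (Continuous.measurable (by fun_prop)).ennreal_ofReal]
  rw [h1, Finset.prod_const, Finset.card_univ, Fintype.card_fin,
    ← ENNReal.ofReal_pow (by positivity), Real.sqrt_eq_rpow, ← Real.rpow_natCast,
    ← Real.rpow_mul (by positivity)]
  congr 2
  ring

/-- Since `⟨B z, t⟩ = ⟨z, Bᵀ t⟩`, this is the standard Gaussian characteristic function at `Bᵀ t`,
and `‖Bᵀ t‖² = tᵀ B Bᵀ t`. Only `B Bᵀ` enters. -/
lemma charFun_map_mulVec_stdNormal {p k : ℕ} (B : Matrix (Fin p) (Fin k) ℝ)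
    (t : EuclideanSpace ℝ (Fin p)) :
    charFun ((stdNormal k).map fun z => WithLp.toLp 2 (B *ᵥ z)) t =
      Complex.exp (-((t.ofLp ⬝ᵥ ((B * Bᵀ) *ᵥ t.ofLp) : ℝ) : ℂ) / 2) := by
  have hB : Measurable fun z : Fin k → ℝ => WithLp.toLp 2 (B *ᵥ z) := by
    have : Continuous fun z : Fin k → ℝ => WithLp.toLp 2 (B *ᵥ z) := by fun_prop
    exact this.measurable
  have hL : Measurable (WithLp.toLp 2 : (Fin k → ℝ) → EuclideanSpace ℝ (Fin k)) := by fun_prop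
  have hstd := charFun_stdGaussian (E := EuclideanSpace ℝ (Fin k))
    (WithLp.toLp 2 (Bᵀ *ᵥ t.ofLp))
  rw [← map_pi_eq_stdGaussian, charFun_apply, integral_map hL.aemeasurable
    (Measurable.aestronglyMeasurable (by fun_prop))] at hstd
  rw [charFun_apply, integral_map hB.aemeasurable (Measurable.aestronglyMeasurable (by fun_prop))]
  have hn : ‖(WithLp.toLp 2 (Bᵀ *ᵥ t.ofLp) : EuclideanSpace ℝ (Fin k))‖ ^ 2 =
      t.ofLp ⬝ᵥ ((B * Bᵀ) *ᵥ t.ofLp) := by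
    rw [EuclideanSpace.real_norm_sq_eq, ← Matrix.mulVec_mulVec, Matrix.dotProduct_mulVec,
      ← Matrix.mulVec_transpose, dotProduct]
    simp only [sq]
  rw [← Complex.ofReal_pow, hn] at hstd
  rw [← hstd]
  refine integral_congr_ae (Filter.Eventually.of_forall fun z => ?_)
  simp only [EuclideanSpace.inner_eq_star_dotProduct, star_trivial]
  rw [Matrix.dotProduct_mulVec, ← Matrix.mulVec_transpose]

/-- Linear images of standard normal vectors with the same covariance have the same law. -/
lemma lintegral_mulVec_stdNormal_congr {p k l : ℕ} {B : Matrix (Fin p) (Fin k) ℝ}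
    {B' : Matrix (Fin p) (Fin l) ℝ} (h : B * Bᵀ = B' * B'ᵀ)
    {F : (Fin p → ℝ) → ℝ≥0∞} (hF : Measurable F) :
    ∫⁻ z, F (B *ᵥ z) ∂stdNormal k = ∫⁻ z, F (B' *ᵥ z) ∂stdNormal l := by
  have hm : ∀ {m : ℕ} (M : Matrix (Fin p) (Fin m) ℝ),
      Measurable fun z : Fin m → ℝ => WithLp.toLp 2 (M *ᵥ z) := fun M => by
    have : Continuous fun z => WithLp.toLp 2 (M *ᵥ z) := by fun_prop
    exact this.measurable
  have key : (stdNormal k).map (fun z => WithLp.toLp 2 (B *ᵥ z)) =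
      (stdNormal l).map fun z => WithLp.toLp 2 (B' *ᵥ z) := by
    have := Measure.isProbabilityMeasure_map (μ := stdNormal k) (hm B).aemeasurable
    have := Measure.isProbabilityMeasure_map (μ := stdNormal l) (hm B').aemeasurable
    refine Measure.ext_of_charFun (funext fun t => ?_)
    rw [charFun_map_mulVec_stdNormal, charFun_map_mulVec_stdNormal, h]
  have hF' : Measurable fun y : EuclideanSpace ℝ (Fin p) => F y.ofLp :=
    hF.comp (by fun_prop)
  have := congrArg (fun m => ∫⁻ y, F y.ofLp ∂m) key
  simpa only [lintegral_map hF' (hm _)] using this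

lemma lintegral_multivariateGaussian_zero_one {p : ℕ} {F : (Fin p → ℝ) → ℝ≥0∞}
    (hF : Measurable F) :
    ∫⁻ z, F z.ofLp ∂(multivariateGaussian (0 : EuclideanSpace ℝ (Fin p)) 1) =
      ∫⁻ z, F z ∂stdNormal p := by
  have hF' : Measurable fun y : EuclideanSpace ℝ (Fin p) => F y.ofLp :=
    hF.comp (by fun_prop)
  rw [multivariateGaussian_zero_one, ← map_pi_eq_stdGaussian, lintegral_map hF' (by fun_prop)]
  rfl

/-! ### The inverse Wishart kernel with identity scale -/

lemma lintegral_gammaMeasure {a r : ℝ} {G : ℝ → ℝ≥0∞} (hG : Measurable G) :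
    ∫⁻ η, G η ∂gammaMeasure a r =
      ENNReal.ofReal (r ^ a / Real.Gamma a) * ∫⁻ η in Set.Ioi (0 : ℝ),
        ENNReal.ofReal (η ^ (a - 1) * Real.exp (-(r * η))) * G η := by
  have hd : Measurable fun η : ℝ =>
      ENNReal.ofReal (η ^ (a - 1) * Real.exp (-(r * η))) * G η :=
    (Measurable.ennreal_ofReal (by fun_prop)).mul hG
  have hpdf : Measurable (gammaPDF a r) := (measurable_gammaPDFReal _ _).ennreal_ofReal
  rw [gammaMeasure, lintegral_withDensity_eq_lintegral_mul _ hpdf hG,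
    ← lintegral_const_mul _ hd, ← lintegral_add_compl _ (measurableSet_Ici (a := (0 : ℝ)))]
  have h0 : ∫⁻ η in (Set.Ici (0 : ℝ))ᶜ, (gammaPDF a r * G) η = 0 := by
    rw [setLIntegral_congr_fun (g := fun _ => 0) measurableSet_Ici.compl]
    · simp
    · intro η hη
      simp only [Set.mem_compl_iff, Set.mem_Ici, not_le] at hη
      simp [gammaPDF_of_neg hη]
  rw [h0, add_zero, setLIntegral_congr Ioi_ae_eq_Ici.symm]
  refine setLIntegral_congr_fun measurableSet_Ioi fun η hη => ?_
  have hη' : 0 < η := hη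
  simp only [Pi.mul_apply]
  rw [gammaPDF_of_nonneg hη'.le, ← mul_assoc, ← ENNReal.ofReal_mul' (by positivity), mul_assoc]

lemma lintegral_chiSquared {ν : ℝ} {G : ℝ → ℝ≥0∞} (hG : Measurable G) :
    ∫⁻ η, G η ∂chiSquared ν =
      ENNReal.ofReal ((1 / 2) ^ (ν / 2) / Real.Gamma (ν / 2)) * ∫⁻ η in Set.Ioi (0 : ℝ),
        ENNReal.ofReal (η ^ (ν / 2 - 1) * Real.exp (-η / 2)) * G η := by
  rw [chiSquared, lintegral_gammaMeasure hG]
  have : ∀ η : ℝ, -(1 / 2 * η) = -η / 2 := fun η => by ring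
  simp only [this]

lemma lintegral_rpow_mul_exp_neg_mul {a r : ℝ} (ha : 0 < a) (hr : 0 < r) :
    ∫⁻ η in Set.Ioi (0 : ℝ), ENNReal.ofReal (η ^ (a - 1) * Real.exp (-(r * η))) =
      ENNReal.ofReal (Real.Gamma a * r ^ (-a)) := by
  have hΓ := Real.Gamma_pos_of_pos ha
  have := isProbabilityMeasure_gammaMeasure ha hr
  have h := lintegral_gammaMeasure (a := a) (r := r) (G := fun _ => 1) measurable_const
  simp only [lintegral_const, measure_univ, mul_one] at h
  have hc : ENNReal.ofReal (Real.Gamma a * r ^ (-a)) * ENNReal.ofReal (r ^ a / Real.Gamma a) =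
      1 := by
    rw [← ENNReal.ofReal_mul (by positivity), Real.rpow_neg hr.le]
    rw [← ENNReal.ofReal_one]
    congr 1
    field_simp
  have h' := congrArg (fun t => ENNReal.ofReal (Real.Gamma a * r ^ (-a)) * t) h
  simp only [mul_one, ← mul_assoc, hc, one_mul] at h'
  exact h'.symm

/-- The substitution `s = 1/η`, which turns a Schur complement into its `χ²` variable. -/
lemma lintegral_Ioi_inv (g : ℝ → ℝ≥0∞) :
    ∫⁻ s in Set.Ioi (0 : ℝ), g s =
      ∫⁻ η in Set.Ioi (0 : ℝ), ENNReal.ofReal ((η ^ 2)⁻¹) * g η⁻¹ := by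
  have himg : Set.image (fun η : ℝ => η⁻¹) (Set.Ioi 0) = Set.Ioi 0 := by
    ext s
    constructor
    · rintro ⟨η, hη, rfl⟩
      exact Set.mem_Ioi.2 (inv_pos.2 hη)
    · intro hs
      exact ⟨s⁻¹, Set.mem_Ioi.2 (inv_pos.2 hs), inv_inv s⟩
  have h := lintegral_image_eq_lintegral_abs_deriv_mul (s := Set.Ioi (0 : ℝ))
    (f := fun η => η⁻¹) (f' := fun η => -(η ^ 2)⁻¹) measurableSet_Ioi
    (fun η hη => (hasDerivAt_inv (ne_of_gt hη)).hasDerivWithinAt) inv_injective.injOn g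
  rw [himg] at h
  rw [h]
  refine lintegral_congr fun η => ?_
  rw [abs_neg, abs_of_nonneg (by positivity)]

lemma lintegral_smul_vec {k : ℕ} {a : ℝ} (ha : a ≠ 0) {F : (Fin k → ℝ) → ℝ≥0∞}
    (hF : Measurable F) :
    ∫⁻ y, F y = ENNReal.ofReal (|a| ^ k) * ∫⁻ y, F (a • y) := by
  have hdet : (a • (1 : Matrix (Fin k) (Fin k) ℝ)).det = a ^ k := by
    simp
  rw [lintegral_mulVec (A := a • (1 : Matrix (Fin k) (Fin k) ℝ)) (by
    rw [hdet]; exact pow_ne_zero _ ha) hF, hdet, abs_pow]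
  simp [Matrix.smul_mulVec]

/-- The constant of proportionality relating a Schur complement and its regression coefficients
to a `χ²` variable and a standard normal vector. -/
def schurConst (k : ℕ) (ν : ℝ) : ℝ :=
  Real.Gamma (ν / 2) * 2 ^ (ν / 2) * (2 * Real.pi) ^ ((k : ℝ) / 2)

lemma schurConst_pos (k : ℕ) {ν : ℝ} (hν : 0 < ν) : 0 < schurConst k ν := by
  have := Real.Gamma_pos_of_pos (half_pos hν)
  have := Real.pi_pos
  unfold schurConst
  positivity

lemma measurable_cons {k : ℕ} {α : Type*} [MeasurableSpace α] {f : α → ℝ} {g : α → Fin k → ℝ}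
    (hf : Measurable f) (hg : Measurable g) :
    Measurable fun a => (Fin.cons (f a) (g a) : Fin (k + 1) → ℝ) := by
  refine measurable_pi_iff.2 fun i => ?_
  refine Fin.cases ?_ (fun i => ?_) i
  · exact hf
  · exact (measurable_pi_apply i).comp hg

/-- Substitute `s = 1/η`, then `β = -z/√η`. The exponent becomes `-(η + zᵀ z)/2`, and the powers of
`η` combine to `d/2 - 2 - k/2 = ν/2 - 1`, the `χ²_ν` exponent. -/
lemma lintegral_schur_kernel {k : ℕ} {d ν : ℝ} (hd : d = ν + k + 2) (hν : 0 < ν)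
    {F : (Fin (k + 1) → ℝ) → ℝ≥0∞} (hF : Measurable F) :
    ∫⁻ β : Fin k → ℝ, ∫⁻ s in Set.Ioi (0 : ℝ),
      ENNReal.ofReal (s ^ (-d / 2) * Real.exp (-(s⁻¹ * (1 + β ⬝ᵥ β)) / 2)) *
        F (s⁻¹ • (Fin.cons 1 (-β) : Fin (k + 1) → ℝ)) =
    ENNReal.ofReal (schurConst k ν) *
      ∫⁻ η, ∫⁻ z, F (Fin.cons η (√η • z)) ∂stdNormal k ∂chiSquared ν := by
  have hpi := Real.pi_pos
  have hΓ := Real.Gamma_pos_of_pos (half_pos hν)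
  have hm : Measurable fun q : (Fin k → ℝ) × ℝ =>
      ENNReal.ofReal (q.2 ^ (-d / 2) * Real.exp (-(q.2⁻¹ * (1 + q.1 ⬝ᵥ q.1)) / 2)) *
        F (q.2⁻¹ • (Fin.cons 1 (-q.1) : Fin (k + 1) → ℝ)) := by
    have h1 : Measurable fun q : (Fin k → ℝ) × ℝ => q.1 ⬝ᵥ q.1 := by
      have : Continuous fun q : (Fin k → ℝ) × ℝ => q.1 ⬝ᵥ q.1 := by fun_prop
      exact this.measurable
    refine (Measurable.ennreal_ofReal (by fun_prop)).mul (hF.comp ?_)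
    exact measurable_snd.inv.smul (measurable_cons measurable_const measurable_fst.neg)
  rw [lintegral_lintegral_swap hm.aemeasurable, lintegral_Ioi_inv]
  have hcons : Measurable fun q : ℝ × (Fin k → ℝ) => F (Fin.cons q.1 (√q.1 • q.2)) :=
    hF.comp (measurable_cons measurable_fst
      ((measurable_fst.sqrt).smul measurable_snd))
  rw [lintegral_chiSquared hcons.lintegral_prod_right', ← mul_assoc,
    ← ENNReal.ofReal_mul (schurConst_pos k hν).le, ← lintegral_const_mul]
  swap
  · exact (Measurable.ennreal_ofReal (by fun_prop)).mul hcons.lintegral_prod_right'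
  refine setLIntegral_congr_fun measurableSet_Ioi fun η hη => ?_
  have hη : 0 < η := hη
  have hz : Measurable fun z : Fin k → ℝ => F (Fin.cons η (√η • z)) :=
    hcons.comp measurable_prodMk_left
  have hs : 0 < √η := Real.sqrt_pos.2 hη
  have hs2 : √η * √η = η := Real.mul_self_sqrt hη.le
  have hmη : Measurable fun x : Fin k → ℝ =>
      ENNReal.ofReal (η⁻¹ ^ (-d / 2) * Real.exp (-(η⁻¹⁻¹ * (1 + x ⬝ᵥ x)) / 2)) *
        F (η⁻¹⁻¹ • (Fin.cons 1 (-x) : Fin (k + 1) → ℝ)) :=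
    hm.comp measurable_prodMk_right
  dsimp only
  -- The scaling factor is negative so that `-β/s` becomes `+√η z`.
  rw [lintegral_stdNormal hz, lintegral_smul_vec (a := -(√η)⁻¹) (by simpa using hs.ne') hmη]
  have hexp : Measurable fun z : Fin k → ℝ => ENNReal.ofReal (Real.exp (-(z ⬝ᵥ z) / 2)) := by
    have : Continuous fun z : Fin k → ℝ => Real.exp (-(z ⬝ᵥ z) / 2) := by fun_prop
    exact this.measurable.ennreal_ofReal
  have hmz : Measurable fun z : Fin k → ℝ =>
      ENNReal.ofReal (η⁻¹ ^ (-d / 2) * Real.exp (-(η⁻¹⁻¹ *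
        (1 + (-(√η)⁻¹ • z) ⬝ᵥ (-(√η)⁻¹ • z))) / 2)) *
        F (η⁻¹⁻¹ • (Fin.cons 1 (-(-(√η)⁻¹ • z)) : Fin (k + 1) → ℝ)) :=
    hmη.comp (measurable_const_smul (α := Fin k → ℝ) (-(√η)⁻¹))
  rw [← mul_assoc, ← mul_assoc, ← mul_assoc, ← ENNReal.ofReal_mul (by positivity),
    ← ENNReal.ofReal_mul (by unfold schurConst; positivity),
    ← ENNReal.ofReal_mul (by unfold schurConst; positivity),
    ← lintegral_const_mul _ hmz, ← lintegral_const_mul _ (by exact hexp.mul hz)]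
  refine lintegral_congr fun z => ?_
  have hvec : (η⁻¹)⁻¹ • (Fin.cons 1 (-(-(√η)⁻¹ • z)) : Fin (k + 1) → ℝ) =
      Fin.cons η (√η • z) := by
    rw [inv_inv]
    ext i
    refine Fin.cases ?_ (fun i => ?_) i
    · simp
    · simp only [Pi.smul_apply, Fin.cons_succ, Pi.neg_apply, smul_eq_mul]
      have h : η * (√η)⁻¹ = √η := by rw [← div_eq_mul_inv, Real.div_sqrt]
      linear_combination z i * h
  rw [hvec, ← mul_assoc, ← mul_assoc, ← ENNReal.ofReal_mul (by positivity),
    ← ENNReal.ofReal_mul (by unfold schurConst; positivity)]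
  congr 2
  have hdot : (-(√η)⁻¹ • z) ⬝ᵥ (-(√η)⁻¹ • z) = η⁻¹ * (z ⬝ᵥ z) := by
    rw [smul_dotProduct, dotProduct_smul, smul_eq_mul, smul_eq_mul, ← mul_assoc]
    congr 1
    rw [neg_mul_neg, ← mul_inv, hs2]
  have habs : |(-(√η)⁻¹)| ^ k = η ^ (-(k : ℝ) / 2) := by
    rw [abs_neg, abs_inv, abs_of_pos hs, Real.sqrt_eq_rpow, ← Real.rpow_neg hη.le,
      ← Real.rpow_natCast, ← Real.rpow_mul hη.le]
    congr 1; ring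
  have hexp2 : Real.exp (-((η⁻¹)⁻¹ * (1 + η⁻¹ * (z ⬝ᵥ z))) / 2) =
      Real.exp (-η / 2) * Real.exp (-(z ⬝ᵥ z) / 2) := by
    rw [← Real.exp_add]
    congr 1
    field_simp
    ring
  have hpow : (η ^ 2)⁻¹ * η ^ (-(k : ℝ) / 2) * (η⁻¹) ^ (-d / 2) = η ^ (ν / 2 - 1) := by
    rw [Real.inv_rpow hη.le, ← Real.rpow_neg hη.le, ← Real.rpow_natCast, ← Real.rpow_neg hη.le,
      ← Real.rpow_add hη, ← Real.rpow_add hη, hd]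
    congr 1
    push_cast
    ring
  have hconst : schurConst k ν * ((1 / 2) ^ (ν / 2) / Real.Gamma (ν / 2)) *
      (2 * Real.pi) ^ (-(k : ℝ) / 2) = 1 := by
    unfold schurConst
    rw [one_div, Real.inv_rpow (by norm_num), neg_div, Real.rpow_neg (by positivity)]
    field_simp
  rw [hdot, habs, hexp2, ← hpow]
  linear_combination (-((η ^ 2)⁻¹ * η ^ (-(k : ℝ) / 2) * (η⁻¹) ^ (-d / 2)) *
    (Real.exp (-η / 2) * Real.exp (-(z ⬝ᵥ z) / 2))) * hconst

/-- The integral of the inverse Wishart kernel with identity scale matrix. -/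
def invWishartConst (k : ℕ) (d : ℝ) : ℝ≥0∞ :=
  ∫⁻ T, ENNReal.ofReal (T.det ^ (-d / 2) * Real.exp (-(T⁻¹).trace / 2)) ∂posDefVolume k

lemma measurable_invWishart_kernel (k : ℕ) (d : ℝ) (S : Matrix (Fin k) (Fin k) ℝ) :
    Measurable fun T : Matrix (Fin k) (Fin k) ℝ =>
      ENNReal.ofReal (T.det ^ (-d / 2) * Real.exp (-(T⁻¹ * S).trace / 2)) := by
  have h1 : Measurable fun T : Matrix (Fin k) (Fin k) ℝ => T.det :=
    Continuous.measurable (by fun_prop)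
  have h2 : Measurable fun T : Matrix (Fin k) (Fin k) ℝ => (T * S).trace :=
    Continuous.measurable (by fun_prop)
  have h3 := h2.comp (measurable_matrix_inv k)
  exact ((h1.pow_const _).mul (h3.neg.div_const 2).exp).ennreal_ofReal

lemma measurable_inv_mulVec {k : ℕ} (v : Fin k → ℝ) :
    Measurable fun T : Matrix (Fin k) (Fin k) ℝ => T⁻¹ *ᵥ v := by
  have h : Continuous fun T : Matrix (Fin k) (Fin k) ℝ => T *ᵥ v := by fun_prop
  exact h.measurable.comp (measurable_matrix_inv k)

/-- In the coordinates `(s, β, T)` determinant and trace split, so the kernel is an inverse Wishart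
kernel in the smaller block times the kernel of `lintegral_schur_kernel`, and `F` sees only the
latter. -/
lemma lintegral_invWishart_one {k : ℕ} {d ν : ℝ} (hd : d = ν + k + 2) (hν : 0 < ν)
    {F : (Fin (k + 1) → ℝ) → ℝ≥0∞} (hF : Measurable F) :
    ∫⁻ T, ENNReal.ofReal (T.det ^ (-d / 2) * Real.exp (-(T⁻¹).trace / 2)) *
        F (T⁻¹ *ᵥ Pi.single 0 1) ∂posDefVolume (k + 1) =
      invWishartConst k (d - 2) * (ENNReal.ofReal (schurConst k ν) *
        ∫⁻ η, ∫⁻ z, F (Fin.cons η (√η • z)) ∂stdNormal k ∂chiSquared ν) := by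
  have hker : ∀ (j : ℕ) (e : ℝ), Measurable fun T : Matrix (Fin j) (Fin j) ℝ =>
      ENNReal.ofReal (T.det ^ (-e / 2) * Real.exp (-(T⁻¹).trace / 2)) := fun j e => by
    simpa using measurable_invWishart_kernel j e 1
  have hm : Measurable fun T : Matrix (Fin (k + 1)) (Fin (k + 1)) ℝ =>
      ENNReal.ofReal (T.det ^ (-d / 2) * Real.exp (-(T⁻¹).trace / 2)) *
        F (T⁻¹ *ᵥ Pi.single 0 1) :=
    (hker _ d).mul (hF.comp (measurable_inv_mulVec _))
  rw [lintegral_posDefVolume_succ hm, ← lintegral_schur_kernel hd hν hF, invWishartConst,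
    ← lintegral_mul_const _ (hker k (d - 2))]
  refine lintegral_congr_ae ((ae_posDef_posDefVolume k).mono fun T hT => ?_)
  have hdet := hT.det_pos
  have hsymm : T.IsSymm := by
    have := hT.isHermitian
    rwa [Matrix.IsHermitian, Matrix.conjTranspose_eq_transpose_of_trivial] at this
  have hq : Measurable fun q : (Fin k → ℝ) × ℝ =>
      ENNReal.ofReal (q.2 ^ (-d / 2) * Real.exp (-(q.2⁻¹ * (1 + q.1 ⬝ᵥ q.1)) / 2)) *
        F (q.2⁻¹ • (Fin.cons 1 (-q.1) : Fin (k + 1) → ℝ)) := by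
    have h1 : Measurable fun q : (Fin k → ℝ) × ℝ => q.1 ⬝ᵥ q.1 := by
      have : Continuous fun q : (Fin k → ℝ) × ℝ => q.1 ⬝ᵥ q.1 := by fun_prop
      exact this.measurable
    refine (Measurable.ennreal_ofReal (by fun_prop)).mul (hF.comp ?_)
    exact measurable_snd.inv.smul (measurable_cons measurable_const measurable_fst.neg)
  dsimp only
  rw [← lintegral_const_mul _ hq.lintegral_prod_right',
    ← lintegral_const_mul' _ _ ENNReal.ofReal_ne_top]
  refine lintegral_congr fun β => ?_
  rw [← lintegral_const_mul' _ _ ENNReal.ofReal_ne_top,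
    ← lintegral_const_mul' _ _ ENNReal.ofReal_ne_top]
  refine setLIntegral_congr_fun measurableSet_Ioi fun s hs => ?_
  have hs : 0 < s := hs
  dsimp only
  rw [det_schurMatrix hsymm, trace_schurMatrix_inv hs.ne' hsymm hdet.ne'.isUnit,
    schurMatrix_inv_mulVec_single hs.ne' hsymm hdet.ne'.isUnit, ← mul_assoc, ← mul_assoc,
    ← ENNReal.ofReal_mul hdet.le, ← ENNReal.ofReal_mul (by positivity)]
  congr 2
  -- The Jacobian `det T` is absorbed here, which lowers the parameter from `d` to `d - 2`.
  have h1 : T.det * T.det ^ (-d / 2) = T.det ^ (-(d - 2) / 2) := by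
    have hk : (0 : ℝ) ≤ k := Nat.cast_nonneg k
    rw [← Real.rpow_one_add' hdet.le (by rw [hd]; intro h; linarith)]
    congr 1; ring
  have h2 : Real.exp (-((T⁻¹).trace + s⁻¹ * (1 + β ⬝ᵥ β)) / 2) =
      Real.exp (-(T⁻¹).trace / 2) * Real.exp (-(s⁻¹ * (1 + β ⬝ᵥ β)) / 2) := by
    rw [← Real.exp_add]; congr 1; ring
  rw [Real.mul_rpow hs.le hdet.le, h2, ← h1]
  ring

lemma isProbabilityMeasure_chiSquared {ν : ℝ} (hν : 0 < ν) :
    IsProbabilityMeasure (chiSquared ν) :=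
  isProbabilityMeasure_gammaMeasure (half_pos hν) (by norm_num)

lemma invWishartConst_succ {k : ℕ} {d ν : ℝ} (hd : d = ν + k + 2) (hν : 0 < ν) :
    invWishartConst (k + 1) d = invWishartConst k (d - 2) * ENNReal.ofReal (schurConst k ν) := by
  have := isProbabilityMeasure_chiSquared hν
  have h := lintegral_invWishart_one hd hν (F := fun _ => 1) measurable_const
  simpa [invWishartConst] using h

/-- There is a single `0 × 0` matrix; it is positive definite, has determinant `1` and carries mass
`1`. -/
lemma invWishartConst_zero (d : ℝ) : invWishartConst 0 d = 1 := by
  have hpd : ∀ T : Matrix (Fin 0) (Fin 0) ℝ, T.PosDef := fun T => by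
    rw [Matrix.posDef_iff_dotProduct_mulVec]
    exact ⟨Subsingleton.elim _ _, fun {x} hx => absurd (Subsingleton.elim _ _) hx⟩
  have hset : {T : Matrix (Fin 0) (Fin 0) ℝ | T.PosDef} = Set.univ :=
    Set.eq_univ_of_forall hpd
  have : Measure.map (symMatrix (k := 0)) volume Set.univ = 1 := by
    rw [Measure.map_apply (measurable_symMatrix 0) MeasurableSet.univ, Set.preimage_univ]
    simp [volume_pi]
  simp [invWishartConst, posDefVolume, hset, Matrix.trace, this]

/-- The recursion sends `(k + 1, d)` to `(k, d - 2)`, which preserves `2 k < d`, and each step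
contributes a positive real factor. -/
lemma invWishartConst_ne_zero_and_ne_top (k : ℕ) {d : ℝ} (hd : 2 * (k : ℝ) < d) :
    invWishartConst k d ≠ 0 ∧ invWishartConst k d ≠ ∞ := by
  induction k generalizing d with
  | zero => simp [invWishartConst_zero]
  | succ k ih =>
    push_cast at hd
    have hk : (0 : ℝ) ≤ k := Nat.cast_nonneg k
    have hν : 0 < d - k - 2 := by linarith
    have h := ih (d := d - 2) (by linarith)
    rw [invWishartConst_succ (ν := d - k - 2) (by ring) hν]
    exact ⟨mul_ne_zero h.1 (ENNReal.ofReal_pos.2 (schurConst_pos k hν)).ne',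
      ENNReal.mul_ne_top h.2 ENNReal.ofReal_ne_top⟩

/-! ### The inverse Wishart kernel with general scale matrix -/

/-- The Householder reflection along `u`. -/
def householder {k : ℕ} (u : Fin k → ℝ) : Matrix (Fin k) (Fin k) ℝ :=
  1 - (2 / (u ⬝ᵥ u)) • vecMulVec u u

lemma householder_transpose {k : ℕ} (u : Fin k → ℝ) : (householder u)ᵀ = householder u := by
  simp [householder, Matrix.transpose_vecMulVec]

lemma householder_mul_self {k : ℕ} (u : Fin k → ℝ) : householder u * householder u = 1 := by
  by_cases hu : u ⬝ᵥ u = 0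
  -- For `u = 0` the convention `2 / 0 = 0` makes the reflection the identity.
  · simp [householder, hu]
  · have h1 : vecMulVec u u * vecMulVec u u = (u ⬝ᵥ u) • vecMulVec u u := by
      rw [Matrix.vecMulVec_mul_vecMulVec]
      ext i j
      simp [vecMulVec_apply]
      ring
    rw [householder, Matrix.sub_mul, Matrix.mul_sub, Matrix.mul_sub]
    simp only [Matrix.one_mul, Matrix.mul_one, Matrix.smul_mul, Matrix.mul_smul, h1, smul_smul]
    have h2 : 2 / (u ⬝ᵥ u) * (2 / (u ⬝ᵥ u) * (u ⬝ᵥ u)) = 2 / (u ⬝ᵥ u) + 2 / (u ⬝ᵥ u) := by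
      field_simp
      ring
    rw [h2, add_smul]
    abel

lemma householder_mulVec {k : ℕ} {w e : Fin k → ℝ} (h : w ⬝ᵥ w = e ⬝ᵥ e) :
    householder (w - e) *ᵥ e = w := by
  by_cases hu : (w - e) ⬝ᵥ (w - e) = 0
  · have h0 : w - e = 0 := dotProduct_self_eq_zero.1 hu
    simp [householder, sub_eq_zero.1 h0]
  · have h1 : (w - e) ⬝ᵥ (w - e) = -2 * ((w - e) ⬝ᵥ e) := by
      simp only [sub_dotProduct, dotProduct_sub, h, dotProduct_comm e w]
      ring
    have h2 : 2 / ((w - e) ⬝ᵥ (w - e)) * ((w - e) ⬝ᵥ e) = -1 := by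
      rw [h1] at hu ⊢
      have : (w - e) ⬝ᵥ e ≠ 0 := fun h => hu (by rw [h]; ring)
      field_simp
    rw [householder, Matrix.sub_mulVec, Matrix.one_mulVec, Matrix.smul_mulVec,
      Matrix.vecMulVec_mulVec]
    ext i
    simp only [Pi.sub_apply, Pi.smul_apply, smul_eq_mul, MulOpposite.smul_eq_mul_unop,
      MulOpposite.unop_op]
    linear_combination (-(w i - e i)) * h2

/-- Any square root of `S` may be multiplied on the right by an orthogonal matrix. A reflection is
chosen that carries a multiple of the first basis vector to `S^(-1/2) v`. -/
lemma exists_factor_of_posDef {k : ℕ} {S : Matrix (Fin (k + 1)) (Fin (k + 1)) ℝ} (hS : S.PosDef)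
    (v : Fin (k + 1) → ℝ) :
    ∃ (A : Matrix (Fin (k + 1)) (Fin (k + 1)) ℝ) (a : ℝ),
      A * Aᵀ = S ∧ A.det ≠ 0 ∧ v = a • (A *ᵥ Pi.single 0 1) := by
  set R := CFC.sqrt S with hR
  have hRR : R * R = S := CFC.sqrt_mul_sqrt_self S hS.posSemidef.nonneg
  have hRT : Rᵀ = R := by
    have := (CFC.sqrt_nonneg S).posSemidef.isHermitian
    rwa [Matrix.IsHermitian, Matrix.conjTranspose_eq_transpose_of_trivial] at this
  have hRdet : R.det ≠ 0 := by
    intro h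
    have := hS.det_pos
    rw [← hRR, Matrix.det_mul, h] at this
    simp at this
  set w := R⁻¹ *ᵥ v with hw
  have hRw : R *ᵥ w = v := by
    rw [hw, Matrix.mulVec_mulVec, Matrix.mul_nonsing_inv _ hRdet.isUnit, Matrix.one_mulVec]
  -- The reflection preserves length, which forces `a` to be the norm of `w` (up to sign).
  set a := √(w ⬝ᵥ w) with ha
  have hnn : 0 ≤ w ⬝ᵥ w := Finset.sum_nonneg fun i _ => mul_self_nonneg _
  set H := householder (w - a • Pi.single 0 1) with hH
  have hHw : H *ᵥ (a • Pi.single 0 1) = w := by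
    refine householder_mulVec ?_
    simp [Real.mul_self_sqrt hnn, ha]
  have hAA : (R * H) * (R * H)ᵀ = S := by
    rw [Matrix.transpose_mul, hRT, hH, householder_transpose, Matrix.mul_assoc,
      ← Matrix.mul_assoc (householder _), householder_mul_self, Matrix.one_mul, hRR]
  refine ⟨R * H, a, hAA, fun h => ?_, ?_⟩
  · have := hS.det_pos
    rw [← hAA, Matrix.det_mul, h] at this
    simp at this
  · rw [← Matrix.mulVec_smul, ← Matrix.mulVec_mulVec, hHw, hRw]

/-! ### Dispersion and law of `L Σ⁻¹ v` -/

lemma posSemidef_vecMulVec_self {k : ℕ} (v : Fin k → ℝ) : (vecMulVec v v).PosSemidef := by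
  simpa using Matrix.posSemidef_vecMulVec_self_star v

/-- The dispersion matrix of `L Σ⁻¹ v` given the inverse scale matrix `V`. -/
def portfolioCov {k p : ℕ} (L : Matrix (Fin p) (Fin k) ℝ) (V : Matrix (Fin k) (Fin k) ℝ)
    (v : Fin k → ℝ) : Matrix (Fin p) (Fin p) ℝ :=
  (v ⬝ᵥ (V *ᵥ v)) • (L * V * Lᵀ) - L * V * vecMulVec v v * V * Lᵀ

/-- With `B = L (Aᵀ)⁻¹` one has `vᵀ S⁻¹ v = a²`, `L S⁻¹ Lᵀ = B Bᵀ` and `L S⁻¹ v = a B e₀`. The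
subtracted term therefore removes exactly the contribution of the first column of `B`. -/
lemma portfolioCov_eq {k p : ℕ} (L : Matrix (Fin p) (Fin (k + 1)) ℝ)
    {S A : Matrix (Fin (k + 1)) (Fin (k + 1)) ℝ} {v : Fin (k + 1) → ℝ} {a : ℝ}
    (hAA : A * Aᵀ = S) (hA : A.det ≠ 0) (hv : v = a • (A *ᵥ Pi.single 0 1)) :
    portfolioCov L S⁻¹ v =
      (a • (L * (Aᵀ)⁻¹).submatrix id Fin.succ) * (a • (L * (Aᵀ)⁻¹).submatrix id Fin.succ)ᵀ := by
  have hAu : A⁻¹ * A = 1 := Matrix.nonsing_inv_mul _ hA.isUnit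
  have hV : S⁻¹ = (Aᵀ)⁻¹ * A⁻¹ := by rw [← hAA, Matrix.mul_inv_rev]
  have hVv : S⁻¹ *ᵥ v = a • ((Aᵀ)⁻¹ *ᵥ Pi.single 0 1) := by
    rw [hV, hv, Matrix.mulVec_smul, Matrix.mulVec_mulVec, Matrix.mul_assoc, hAu, Matrix.mul_one]
  have hVT : (S⁻¹)ᵀ = S⁻¹ := by
    rw [← hAA, Matrix.transpose_nonsing_inv, Matrix.transpose_mul, Matrix.transpose_transpose]
  have hq : v ⬝ᵥ (S⁻¹ *ᵥ v) = a ^ 2 := by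
    rw [hVv, hv, smul_dotProduct, dotProduct_smul, Matrix.dotProduct_mulVec,
      ← Matrix.vecMul_transpose, Matrix.vecMul_vecMul,
      Matrix.mul_nonsing_inv _ (by rw [Matrix.det_transpose]; exact hA.isUnit), Matrix.vecMul_one]
    simp [sq]
  set B := L * (Aᵀ)⁻¹ with hB
  have hBT : Bᵀ = A⁻¹ * Lᵀ := by
    rw [hB, Matrix.transpose_mul, ← Matrix.transpose_nonsing_inv, Matrix.transpose_transpose]
  have h1 : L * S⁻¹ * Lᵀ = B * Bᵀ := by
    rw [hBT, hV, hB]; simp only [Matrix.mul_assoc]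
  have h2 : L * S⁻¹ * vecMulVec v v * S⁻¹ * Lᵀ =
      vecMulVec (a • (B *ᵥ Pi.single 0 1)) (a • (B *ᵥ Pi.single 0 1)) := by
    have h3 : L *ᵥ (S⁻¹ *ᵥ v) = a • (B *ᵥ Pi.single 0 1) := by
      rw [hVv, Matrix.mulVec_smul, Matrix.mulVec_mulVec]
    rw [← h3, Matrix.mul_vecMulVec, Matrix.vecMulVec_mul, Matrix.vecMulVec_mul,
      ← Matrix.mulVec_mulVec, ← Matrix.mulVec_transpose S⁻¹, hVT, Matrix.vecMul_transpose]
  rw [portfolioCov, hq, h1, h2]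
  ext i j
  simp only [Matrix.sub_apply, Matrix.smul_apply, Matrix.mul_apply, Fin.sum_univ_succ,
    Matrix.transpose_apply, vecMulVec_apply, Pi.smul_apply, Matrix.mulVec_single_one,
    Matrix.col_apply, Matrix.submatrix_apply, id, smul_eq_mul]
  have : ∑ l : Fin k, a * B i l.succ * (a * B j l.succ) =
      a ^ 2 * ∑ l : Fin k, B i l.succ * B j l.succ := by
    rw [Finset.mul_sum]
    exact Finset.sum_congr rfl fun l _ => by ring
  rw [this]
  ring

/-- A Gram matrix by `portfolioCov_eq`. It is needed because `CFC.sqrt` squares back to its argument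
only on positive semidefinite matrices. -/
lemma posSemidef_portfolioCov {k p : ℕ} (L : Matrix (Fin p) (Fin (k + 1)) ℝ)
    {S : Matrix (Fin (k + 1)) (Fin (k + 1)) ℝ} (hS : S.PosDef) (v : Fin (k + 1) → ℝ) :
    (portfolioCov L S⁻¹ v).PosSemidef := by
  obtain ⟨A, a, hAA, hA, hv⟩ := exists_factor_of_posDef hS v
  rw [portfolioCov_eq L hAA hA hv]
  have := Matrix.posSemidef_self_mul_conjTranspose (a • (L * (Aᵀ)⁻¹).submatrix id Fin.succ)
  rwa [Matrix.conjTranspose_eq_transpose_of_trivial] at this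

/-- Congruence by `A` reduces to identity scale with `v` along the first axis. The first column of
`B` carries the `χ²` part, the other columns the Gaussian part. -/
lemma lintegral_invWishart {k p : ℕ} {d ν : ℝ} (hd : d = ν + k + 2) (hν : 0 < ν)
    (L : Matrix (Fin p) (Fin (k + 1)) ℝ) {S : Matrix (Fin (k + 1)) (Fin (k + 1)) ℝ}
    (hS : S.PosDef) (v : Fin (k + 1) → ℝ) {F : (Fin p → ℝ) → ℝ≥0∞} (hF : Measurable F) :
    ∫⁻ T, ENNReal.ofReal (T.det ^ (-d / 2) * Real.exp (-(T⁻¹ * S).trace / 2)) *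
        F (L *ᵥ (T⁻¹ *ᵥ v)) ∂posDefVolume (k + 1) =
      invWishartConst (k + 1) d * (ENNReal.ofReal (S.det ^ (-ν / 2)) *
        ∫⁻ η, ∫⁻ z, F (η • ((L * S⁻¹) *ᵥ v) + √η • (CFC.sqrt (portfolioCov L S⁻¹ v) *ᵥ z))
          ∂stdNormal p ∂chiSquared ν) := by
  obtain ⟨A, a, hAA, hA, hv⟩ := exists_factor_of_posDef hS v
  have hm : Measurable fun T : Matrix (Fin (k + 1)) (Fin (k + 1)) ℝ =>
      ENNReal.ofReal (T.det ^ (-d / 2) * Real.exp (-(T⁻¹ * S).trace / 2)) *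
        F (L *ᵥ (T⁻¹ *ᵥ v)) := by
    refine (measurable_invWishart_kernel _ d S).mul (hF.comp ?_)
    have h : Continuous fun y : Fin (k + 1) → ℝ => L *ᵥ y := by fun_prop
    exact h.measurable.comp (measurable_inv_mulVec v)
  set B := L * (Aᵀ)⁻¹ with hB
  have hAT : IsUnit Aᵀ.det := by rw [Matrix.det_transpose]; exact hA.isUnit
  have hAu : A⁻¹ * A = 1 := Matrix.nonsing_inv_mul _ hA.isUnit
  have hdetS : S.det = |A.det| ^ 2 := by
    rw [← hAA, Matrix.det_mul, Matrix.det_transpose, sq_abs, sq]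
  have hapos : 0 < |A.det| := abs_pos.2 hA
  -- The Jacobian in dimension `k + 1` is `|det A|^(k+2)`, the kernel gives `|det A|^(-d)`, and `d -
  -- (k + 2) = ν`.
  have hscale : |A.det| ^ (k + 1 + 1) * (|A.det| ^ 2) ^ (-d / 2) = S.det ^ (-ν / 2) := by
    rw [hdetS, ← Real.rpow_natCast, ← Real.rpow_natCast, ← Real.rpow_mul hapos.le,
      ← Real.rpow_mul hapos.le, ← Real.rpow_add hapos, hd]
    congr 1
    push_cast
    ring
  have hG : Measurable fun y : Fin (k + 1) → ℝ => F (a • (B *ᵥ y)) := by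
    have h : Continuous fun y : Fin (k + 1) → ℝ => a • (B *ᵥ y) := by fun_prop
    exact hF.comp h.measurable
  have hstep : ∫⁻ T, ENNReal.ofReal ((A * T * Aᵀ).det ^ (-d / 2) *
      Real.exp (-((A * T * Aᵀ)⁻¹ * S).trace / 2)) * F (L *ᵥ ((A * T * Aᵀ)⁻¹ *ᵥ v))
        ∂posDefVolume (k + 1) =
      ENNReal.ofReal ((|A.det| ^ 2) ^ (-d / 2)) *
        ∫⁻ T, ENNReal.ofReal (T.det ^ (-d / 2) * Real.exp (-(T⁻¹).trace / 2)) *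
        F (a • (B *ᵥ (T⁻¹ *ᵥ Pi.single 0 1))) ∂posDefVolume (k + 1) := by
    rw [← lintegral_const_mul' _ _ ENNReal.ofReal_ne_top]
    refine lintegral_congr_ae ((ae_posDef_posDefVolume (k + 1)).mono fun T hT => ?_)
    have hinv : (A * T * Aᵀ)⁻¹ = (Aᵀ)⁻¹ * T⁻¹ * A⁻¹ := by
      rw [Matrix.mul_inv_rev, Matrix.mul_inv_rev, Matrix.mul_assoc]
    have htr : ((A * T * Aᵀ)⁻¹ * S).trace = (T⁻¹).trace := by
      rw [hinv, ← hAA, Matrix.mul_assoc, ← Matrix.mul_assoc A⁻¹, hAu, Matrix.one_mul,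
        Matrix.mul_assoc, Matrix.trace_mul_comm, Matrix.mul_assoc,
        Matrix.mul_nonsing_inv _ hAT, Matrix.mul_one]
    have hvec : L *ᵥ ((A * T * Aᵀ)⁻¹ *ᵥ v) = a • (B *ᵥ (T⁻¹ *ᵥ Pi.single 0 1)) := by
      rw [hinv, hv]
      simp only [Matrix.mulVec_smul, Matrix.mulVec_mulVec, hB, Matrix.mul_assoc, hAu,
        Matrix.mul_one]
    have hdet : (A * T * Aᵀ).det = |A.det| ^ 2 * T.det := by
      rw [Matrix.det_mul, Matrix.det_mul, Matrix.det_transpose, sq_abs]; ring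
    dsimp only
    rw [htr, hvec, hdet, Real.mul_rpow (by positivity) hT.det_pos.le, ← mul_assoc,
      ← ENNReal.ofReal_mul (by positivity), mul_assoc]
  have hbase := lintegral_invWishart_one hd hν hG
  rw [lintegral_posDefVolume_congr hA hm, hstep, ← mul_assoc,
    ← ENNReal.ofReal_mul (by positivity), hscale, hbase, invWishartConst_succ hd hν]
  -- The `k` normals entering through the columns of `B` are traded for `p` normals entering through
  -- the positive semidefinite root; both have the same covariance.
  have hlaw : ∀ η : ℝ, ∫⁻ z, F (a • (B *ᵥ (Fin.cons η (√η • z) : Fin (k + 1) → ℝ)))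
        ∂stdNormal k =
      ∫⁻ z, F (η • ((L * S⁻¹) *ᵥ v) + √η • (CFC.sqrt (portfolioCov L S⁻¹ v) *ᵥ z))
        ∂stdNormal p := by
    intro η
    have hQ := posSemidef_portfolioCov L hS v
    have hsq : CFC.sqrt (portfolioCov L S⁻¹ v) * (CFC.sqrt (portfolioCov L S⁻¹ v))ᵀ =
        (a • B.submatrix id Fin.succ) * (a • B.submatrix id Fin.succ)ᵀ := by
      have := (CFC.sqrt_nonneg (portfolioCov L S⁻¹ v)).posSemidef.isHermitian
      rw [Matrix.IsHermitian, Matrix.conjTranspose_eq_transpose_of_trivial] at this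
      rw [this, CFC.sqrt_mul_sqrt_self _ hQ.nonneg, portfolioCov_eq L hAA hA hv]
    have hF' : Measurable fun y : Fin p → ℝ => F (η • ((L * S⁻¹) *ᵥ v) + √η • y) := by
      have h : Continuous fun y : Fin p → ℝ => η • ((L * S⁻¹) *ᵥ v) + √η • y := by fun_prop
      exact hF.comp h.measurable
    rw [lintegral_mulVec_stdNormal_congr hsq hF']
    refine lintegral_congr fun z => ?_
    congr 1
    have hmean : (L * S⁻¹) *ᵥ v = a • (B *ᵥ Pi.single 0 1) := by
      rw [← hAA, Matrix.mul_inv_rev, hv, Matrix.mulVec_smul, Matrix.mulVec_mulVec,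
        Matrix.mul_assoc, Matrix.mul_assoc, hAu, Matrix.mul_one]
    rw [hmean]
    ext i
    simp only [Pi.smul_apply, Pi.add_apply, smul_eq_mul, Matrix.mulVec, dotProduct,
      Fin.sum_univ_succ, Fin.cons_zero, Fin.cons_succ, Matrix.smul_apply, Matrix.submatrix_apply,
      id, Pi.single_eq_same, Pi.single_eq_of_ne (Fin.succ_ne_zero _), mul_zero, mul_one,
      Finset.sum_const_zero, add_zero, mul_add, Finset.mul_sum]
    congr 1
    · ring
    · exact Finset.sum_congr rfl fun l _ => by ring
  simp only [hlaw]
  ring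

/-! ### Measurability of the square root -/

/-- On the positive semidefinite cone the root inverts the continuous map `B ↦ B * B`, which is
injective there, so preimages under the root are injective continuous images of Borel sets
(Lusin–Souslin). Off the cone `CFC.sqrt` has the default value `0`. -/
lemma measurable_matrix_sqrt (p : ℕ) :
    Measurable fun Q : Matrix (Fin p) (Fin p) ℝ => CFC.sqrt Q := by
  intro s hs
  set P := {Q : Matrix (Fin p) (Fin p) ℝ | Q.PosSemidef} with hP
  have hPm : MeasurableSet P := (isClosed_setOf_posSemidef p).measurableSet
  have himg : MeasurableSet (Set.image (fun B : Matrix (Fin p) (Fin p) ℝ => B * B) (s ∩ P)) := by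
    refine (hs.inter hPm).image_of_continuousOn_injOn (Continuous.continuousOn (by fun_prop)) ?_
    intro B hB B' hB' h
    have hB0 : B.PosSemidef := hB.2
    have hB0' : B'.PosSemidef := hB'.2
    have h := congrArg CFC.sqrt h
    dsimp only at h
    rwa [CFC.sqrt_mul_self B hB0.nonneg, CFC.sqrt_mul_self B' hB0'.nonneg] at h
  have hpre : (fun Q : Matrix (Fin p) (Fin p) ℝ => CFC.sqrt Q) ⁻¹' s =
      Set.image (fun B : Matrix (Fin p) (Fin p) ℝ => B * B) (s ∩ P) ∪
        (Pᶜ ∩ {_Q | (0 : Matrix _ _ ℝ) ∈ s}) := by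
    ext Q
    constructor
    · intro hQ
      by_cases hQP : Q.PosSemidef
      · exact Or.inl ⟨CFC.sqrt Q, ⟨hQ, (CFC.sqrt_nonneg Q).posSemidef⟩,
          CFC.sqrt_mul_sqrt_self Q hQP.nonneg⟩
      · refine Or.inr ⟨hQP, ?_⟩
        have h0 : CFC.sqrt Q = 0 :=
          CFC.sqrt_of_not_nonneg fun h => hQP h.posSemidef
        have hQ : CFC.sqrt Q ∈ s := hQ
        rwa [h0] at hQ
    · rintro (⟨B, ⟨hBs, hBP⟩, rfl⟩ | ⟨hQP, h0⟩)
      · have hB0 : B.PosSemidef := hBP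
        change CFC.sqrt (B * B) ∈ s
        rwa [CFC.sqrt_mul_self B hB0.nonneg]
      · have h1 : CFC.sqrt Q = 0 :=
          CFC.sqrt_of_not_nonneg fun h => hQP h.posSemidef
        change CFC.sqrt Q ∈ s
        rwa [h1]
  rw [hpre]
  exact himg.union (hPm.compl.inter (MeasurableSet.const _))

/-! ### The multivariate `t`-distribution -/

lemma det_add_smul_vecMulVec {k : ℕ} {S : Matrix (Fin k) (Fin k) ℝ} (hS : S.det ≠ 0) (r : ℝ)
    (u : Fin k → ℝ) :
    (S + r • vecMulVec u u).det = S.det * (1 + r * (u ⬝ᵥ (S⁻¹ *ᵥ u))) := by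
  have h1 : S + r • vecMulVec u u = S * (1 + vecMulVec (r • (S⁻¹ *ᵥ u)) u) := by
    rw [Matrix.mul_add, Matrix.mul_one, Matrix.mul_vecMulVec, Matrix.mulVec_smul,
      Matrix.mulVec_mulVec, Matrix.mul_nonsing_inv _ hS.isUnit, Matrix.one_mulVec,
      Matrix.smul_vecMulVec]
  rw [h1, Matrix.det_mul, Matrix.vecMulVec_eq Unit, Matrix.det_one_add_replicateCol_mul_replicateRow,
    dotProduct_smul, smul_eq_mul]

lemma posDef_add_smul_vecMulVec {k : ℕ} {S : Matrix (Fin k) (Fin k) ℝ} (hS : S.PosDef) {r : ℝ}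
    (hr : 0 ≤ r) (u : Fin k → ℝ) : (S + r • vecMulVec u u).PosDef :=
  hS.add_posSemidef ((posSemidef_vecMulVec_self u).smul hr)

lemma dotProduct_inv_mulVec_nonneg {k : ℕ} {S : Matrix (Fin k) (Fin k) ℝ} (hS : S.PosDef)
    (u : Fin k → ℝ) : 0 ≤ u ⬝ᵥ (S⁻¹ *ᵥ u) := by
  simpa using hS.inv.posSemidef.dotProduct_mulVec_nonneg u

lemma lintegral_exp_neg_quadratic {k : ℕ} {S : Matrix (Fin (k + 1)) (Fin (k + 1)) ℝ}
    (hS : S.PosDef) (m : Fin (k + 1) → ℝ) {b : ℝ} (hb : 0 < b) :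
    ∫⁻ y, ENNReal.ofReal (Real.exp (-(b * ((y - m) ⬝ᵥ (S⁻¹ *ᵥ (y - m)))))) =
      ENNReal.ofReal (S.det ^ ((1 : ℝ) / 2) * (Real.pi / b) ^ (((k + 1 : ℕ) : ℝ) / 2)) := by
  obtain ⟨A, -, hAA, hA, -⟩ := exists_factor_of_posDef hS 0
  have hAT : IsUnit Aᵀ.det := by rw [Matrix.det_transpose]; exact hA.isUnit
  have hq : ∀ y, (A *ᵥ y) ⬝ᵥ (S⁻¹ *ᵥ (A *ᵥ y)) = y ⬝ᵥ y := by
    intro y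
    rw [← hAA, Matrix.mul_inv_rev, Matrix.mulVec_mulVec, Matrix.mul_assoc,
      Matrix.nonsing_inv_mul _ hA.isUnit, Matrix.mul_one, Matrix.dotProduct_mulVec,
      ← Matrix.vecMul_transpose, Matrix.vecMul_vecMul, Matrix.mul_nonsing_inv _ hAT,
      Matrix.vecMul_one]
  have hm : Measurable fun y : Fin (k + 1) → ℝ =>
      ENNReal.ofReal (Real.exp (-(b * (y ⬝ᵥ (S⁻¹ *ᵥ y))))) := by
    have : Continuous fun y : Fin (k + 1) → ℝ => Real.exp (-(b * (y ⬝ᵥ (S⁻¹ *ᵥ y)))) := by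
      fun_prop
    exact this.measurable.ennreal_ofReal
  rw [lintegral_sub_right_eq_self
    (fun y : Fin (k + 1) → ℝ => ENNReal.ofReal (Real.exp (-(b * (y ⬝ᵥ (S⁻¹ *ᵥ y)))))) m,
    lintegral_mulVec hA hm]
  simp only [hq]
  rw [lintegral_exp_neg_mul_dotProduct _ hb, ← ENNReal.ofReal_mul (abs_nonneg _)]
  congr 2
  rw [← hAA, Matrix.det_mul, Matrix.det_transpose, ← Real.sqrt_eq_rpow, Real.sqrt_mul_self_eq_abs]

/-- The `t` kernel is a Gamma mixture of Gaussians: write `R^(-a)` as `Γ(a)⁻¹ ∫ η^(a-1) e^(-Rη) dη`,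
exchange the integrals, integrate out `y`, then `η`. -/
lemma lintegral_t_kernel {k : ℕ} {S : Matrix (Fin (k + 1)) (Fin (k + 1)) ℝ} (hS : S.PosDef)
    (m : Fin (k + 1) → ℝ) {r δ : ℝ} (hr : 0 < r) (hδ : 0 < δ) :
    ∫⁻ y, ENNReal.ofReal
        ((1 + r * ((y - m) ⬝ᵥ (S⁻¹ *ᵥ (y - m)))) ^ (-(δ + (k + 1 : ℕ)) / 2)) =
      ENNReal.ofReal (Real.Gamma (δ / 2) * (Real.pi / r) ^ (((k + 1 : ℕ) : ℝ) / 2) *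
        S.det ^ ((1 : ℝ) / 2) / Real.Gamma ((δ + (k + 1 : ℕ)) / 2)) := by
  have hdet := hS.det_pos
  have hpi := Real.pi_pos
  set κ : ℝ := ((k + 1 : ℕ) : ℝ) with hκ
  have hκ0 : 0 ≤ κ := Nat.cast_nonneg _
  have ha : 0 < (δ + κ) / 2 := by positivity
  have hΓ := Real.Gamma_pos_of_pos ha
  have hΓ' := Real.Gamma_pos_of_pos (half_pos hδ)
  set q : (Fin (k + 1) → ℝ) → ℝ := fun y => (y - m) ⬝ᵥ (S⁻¹ *ᵥ (y - m)) with hqdef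
  have hq0 : ∀ y, 0 ≤ q y := fun y => dotProduct_inv_mulVec_nonneg hS _
  have hqm : Measurable q := by
    have : Continuous q := by fun_prop
    exact this.measurable
  have h1 : ∀ y, ENNReal.ofReal ((1 + r * q y) ^ (-(δ + κ) / 2)) =
      ENNReal.ofReal (Real.Gamma ((δ + κ) / 2))⁻¹ * ∫⁻ η in Set.Ioi (0 : ℝ),
        ENNReal.ofReal (η ^ ((δ + κ) / 2 - 1) * Real.exp (-((1 + r * q y) * η))) := by
    intro y
    have hR : 0 < 1 + r * q y := by have := hq0 y; positivity
    rw [lintegral_rpow_mul_exp_neg_mul ha hR, ← ENNReal.ofReal_mul (by positivity), ← mul_assoc,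
      inv_mul_cancel₀ hΓ.ne', one_mul]
    congr 2; ring
  have hm : Measurable fun z : (Fin (k + 1) → ℝ) × ℝ =>
      ENNReal.ofReal (z.2 ^ ((δ + κ) / 2 - 1) * Real.exp (-((1 + r * q z.1) * z.2))) :=
    Measurable.ennreal_ofReal (by fun_prop)
  change ∫⁻ y, ENNReal.ofReal ((1 + r * q y) ^ (-(δ + κ) / 2)) = _
  simp only [h1]
  rw [lintegral_const_mul _ hm.lintegral_prod_right', lintegral_lintegral_swap hm.aemeasurable]
  have h2 : ∫⁻ η in Set.Ioi (0 : ℝ), ∫⁻ y,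
      ENNReal.ofReal (η ^ ((δ + κ) / 2 - 1) * Real.exp (-((1 + r * q y) * η))) =
      ∫⁻ η in Set.Ioi (0 : ℝ), ENNReal.ofReal ((Real.pi / r) ^ (κ / 2) * S.det ^ ((1 : ℝ) / 2)) *
        ENNReal.ofReal (η ^ (δ / 2 - 1) * Real.exp (-(1 * η))) := by
    refine setLIntegral_congr_fun measurableSet_Ioi fun η hη => ?_
    have hη : 0 < η := hη
    have h3 : ∀ y, ENNReal.ofReal (η ^ ((δ + κ) / 2 - 1) * Real.exp (-((1 + r * q y) * η))) =
        ENNReal.ofReal (η ^ ((δ + κ) / 2 - 1) * Real.exp (-η)) *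
          ENNReal.ofReal (Real.exp (-((η * r) * q y))) := by
      intro y
      rw [← ENNReal.ofReal_mul (by positivity), mul_assoc, ← Real.exp_add]
      congr 3; ring
    simp only [h3]
    rw [lintegral_const_mul' _ _ ENNReal.ofReal_ne_top,
      lintegral_exp_neg_quadratic hS m (mul_pos hη hr), ← ENNReal.ofReal_mul (by positivity),
      ← ENNReal.ofReal_mul (by positivity)]
    congr 1
    have h4 : (Real.pi / (η * r)) ^ (κ / 2) = (Real.pi / r) ^ (κ / 2) * η ^ (-(κ / 2)) := by
      rw [Real.rpow_neg hη.le, ← Real.inv_rpow hη.le, ← Real.mul_rpow (by positivity)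
        (by positivity)]
      congr 1; field_simp
    have h5 : η ^ ((δ + κ) / 2 - 1) * η ^ (-(κ / 2)) = η ^ (δ / 2 - 1) := by
      rw [← Real.rpow_add hη]; congr 1; ring
    rw [← hκ, h4, ← h5, one_mul]
    ring
  rw [h2, lintegral_const_mul' _ _ ENNReal.ofReal_ne_top,
    lintegral_rpow_mul_exp_neg_mul (half_pos hδ) one_pos, ← ENNReal.ofReal_mul (by positivity),
    ← ENNReal.ofReal_mul (by positivity), Real.one_rpow]
  congr 1
  field_simp

/-- The constant normalizing `y ↦ |S + r (y - m)(y - m)ᵀ| ^ (-(δ + k) / 2)`. -/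
def tConst {k : ℕ} (δ r : ℝ) (S : Matrix (Fin k) (Fin k) ℝ) : ℝ :=
  Real.Gamma ((δ + k) / 2) * S.det ^ ((δ + k) / 2) /
    (Real.Gamma (δ / 2) * (Real.pi / r) ^ ((k : ℝ) / 2) * S.det ^ ((1 : ℝ) / 2))

lemma tConst_pos {k : ℕ} {δ r : ℝ} {S : Matrix (Fin k) (Fin k) ℝ} (hS : S.PosDef) (hr : 0 < r)
    (hδ : 0 < δ) : 0 < tConst δ r S := by
  have := hS.det_pos
  have := Real.pi_pos
  have := Real.Gamma_pos_of_pos (half_pos hδ)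
  have := Real.Gamma_pos_of_pos (s := (δ + k) / 2) (by positivity)
  unfold tConst
  positivity

lemma measurable_t_kernel {k : ℕ} (r ν : ℝ) (S : Matrix (Fin k) (Fin k) ℝ) (m : Fin k → ℝ) :
    Measurable fun y : Fin k → ℝ =>
      ENNReal.ofReal ((S + r • vecMulVec (y - m) (y - m)).det ^ (-ν / 2)) := by
  have : Continuous fun y : Fin k → ℝ => (S + r • vecMulVec (y - m) (y - m)).det := by
    simp only [vecMulVec_eq Unit]
    fun_prop
  exact (this.measurable.pow_const _).ennreal_ofReal

/-- By the matrix determinant lemma `|S + r u uᵀ| = |S| (1 + r uᵀ S⁻¹ u)`, and the dispersion `(r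
δ)⁻¹ S` is the one for which the quadratic form divided by `δ` is `r uᵀ S⁻¹ u`. -/
lemma multiT_eq_withDensity {k : ℕ} {S : Matrix (Fin k) (Fin k) ℝ} (hS : S.PosDef)
    (m : Fin k → ℝ) {r δ : ℝ} (hr : 0 < r) (hδ : 0 < δ) :
    multiT δ m ((r * δ)⁻¹ • S) = volume.withDensity fun y => ENNReal.ofReal (tConst δ r S) *
      ENNReal.ofReal ((S + r • vecMulVec (y - m) (y - m)).det ^ (-(δ + k) / 2)) := by
  have hdet := hS.det_pos
  have hpi := Real.pi_pos
  have hinv : ((r * δ)⁻¹ • S)⁻¹ = (r * δ) • S⁻¹ := by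
    refine Matrix.inv_eq_right_inv ?_
    rw [Matrix.smul_mul, Matrix.mul_smul, Matrix.mul_nonsing_inv _ hdet.ne'.isUnit, smul_smul,
      inv_mul_cancel₀ (by positivity), one_smul]
  have hΓ := Real.Gamma_pos_of_pos (half_pos hδ)
  rw [multiT]
  congr 1
  ext y
  rw [← ENNReal.ofReal_mul (tConst_pos hS hr hδ).le, det_add_smul_vecMulVec hdet.ne', hinv]
  congr 1
  have hq := dotProduct_inv_mulVec_nonneg hS (y - m)
  rw [Matrix.smul_mulVec, dotProduct_smul, smul_eq_mul,
    Real.mul_rpow hdet.le (by positivity)]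
  have h1 : r * δ * ((y - m) ⬝ᵥ (S⁻¹ *ᵥ (y - m))) / δ = r * ((y - m) ⬝ᵥ (S⁻¹ *ᵥ (y - m))) := by
    field_simp
  have h2 : ((r * δ)⁻¹ • S).det ^ ((1 : ℝ) / 2) =
      (r * δ) ^ (-((k : ℝ) / 2)) * S.det ^ ((1 : ℝ) / 2) := by
    rw [Matrix.det_smul, Fintype.card_fin, Real.mul_rpow (by positivity) hdet.le,
      ← Real.rpow_natCast, ← Real.rpow_mul (by positivity), Real.inv_rpow (by positivity),
      ← Real.rpow_neg (by positivity)]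
    congr 2; ring
  have h3 : (δ * Real.pi) ^ ((k : ℝ) / 2) * (r * δ) ^ (-((k : ℝ) / 2)) =
      (Real.pi / r) ^ ((k : ℝ) / 2) := by
    rw [Real.rpow_neg (by positivity), ← Real.inv_rpow (by positivity),
      ← Real.mul_rpow (by positivity) (by positivity)]
    congr 1; field_simp
  have h4 : S.det ^ ((δ + k) / 2) * S.det ^ (-(δ + k) / 2) = 1 := by
    rw [← Real.rpow_add hdet, neg_div, add_neg_cancel, Real.rpow_zero]
  rw [h1, h2, tConst, ← h3]
  linear_combination (-(Real.Gamma ((δ + k) / 2) /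
    (Real.Gamma (δ / 2) * ((δ * Real.pi) ^ ((k : ℝ) / 2) * (r * δ) ^ (-((k : ℝ) / 2))) *
      S.det ^ ((1 : ℝ) / 2)) * (1 + r * ((y - m) ⬝ᵥ (S⁻¹ *ᵥ (y - m)))) ^ (-(δ + k) / 2))) * h4

lemma lintegral_multiT {k : ℕ} {S : Matrix (Fin k) (Fin k) ℝ} (hS : S.PosDef)
    (m : Fin k → ℝ) {r δ : ℝ} (hr : 0 < r) (hδ : 0 < δ) {G : (Fin k → ℝ) → ℝ≥0∞}
    (hG : Measurable G) :
    ∫⁻ y, G y ∂multiT δ m ((r * δ)⁻¹ • S) = ENNReal.ofReal (tConst δ r S) *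
      ∫⁻ y, ENNReal.ofReal ((S + r • vecMulVec (y - m) (y - m)).det ^ (-(δ + k) / 2)) * G y := by
  have hm := measurable_t_kernel r (δ + k) S m
  rw [multiT_eq_withDensity hS m hr hδ, lintegral_withDensity_eq_lintegral_mul _
    (hm.const_mul _) hG, ← lintegral_const_mul _ (by exact hm.mul hG)]
  exact lintegral_congr fun y => mul_assoc _ _ _

lemma isProbabilityMeasure_multiT {k : ℕ} {S : Matrix (Fin (k + 1)) (Fin (k + 1)) ℝ}
    (hS : S.PosDef) (m : Fin (k + 1) → ℝ) {r δ : ℝ} (hr : 0 < r) (hδ : 0 < δ) :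
    IsProbabilityMeasure (multiT δ m ((r * δ)⁻¹ • S)) := by
  have hdet := hS.det_pos
  have hpi := Real.pi_pos
  have hΓ := Real.Gamma_pos_of_pos (half_pos hδ)
  have hΓ' := Real.Gamma_pos_of_pos (s := (δ + (k + 1 : ℕ)) / 2) (by positivity)
  refine ⟨?_⟩
  rw [← lintegral_one, lintegral_multiT hS m hr hδ measurable_const]
  have h : ∀ y : Fin (k + 1) → ℝ, ENNReal.ofReal
      ((S + r • vecMulVec (y - m) (y - m)).det ^ (-(δ + (k + 1 : ℕ)) / 2)) * 1 =
      ENNReal.ofReal (S.det ^ (-(δ + (k + 1 : ℕ)) / 2)) * ENNReal.ofReal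
        ((1 + r * ((y - m) ⬝ᵥ (S⁻¹ *ᵥ (y - m)))) ^ (-(δ + (k + 1 : ℕ)) / 2)) := by
    intro y
    have hq := dotProduct_inv_mulVec_nonneg hS (y - m)
    rw [mul_one, ← ENNReal.ofReal_mul (by positivity), det_add_smul_vecMulVec hdet.ne',
      Real.mul_rpow hdet.le (by positivity)]
  simp only [h]
  rw [lintegral_const_mul' _ _ ENNReal.ofReal_ne_top, lintegral_t_kernel hS m hr hδ,
    ← ENNReal.ofReal_mul (by positivity), ← ENNReal.ofReal_mul (tConst_pos hS hr hδ).le,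
    ← ENNReal.ofReal_one]
  congr 1
  rw [tConst, neg_div, Real.rpow_neg hdet.le]
  field_simp

/-! ### The joint posterior law of `μ` and the portfolio weights -/

/-- The normal-inverse-Wishart kernel. -/
def niwKernel {k : ℕ} (d : ℝ) (Sstar : (Fin k → ℝ) → Matrix (Fin k) (Fin k) ℝ)
    (θ : (Fin k → ℝ) × Matrix (Fin k) (Fin k) ℝ) : ℝ :=
  θ.2.det ^ (-d / 2) * Real.exp (-(θ.2⁻¹ * Sstar θ.1).trace / 2)

lemma refMeasure_eq (k : ℕ) :
    refMeasure k = (volume : Measure (Fin k → ℝ)).prod (posDefVolume k) := rfl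

lemma ae_posDef_refMeasure (k : ℕ) : ∀ᵐ θ ∂refMeasure k, θ.2.PosDef :=
  Measure.quasiMeasurePreserving_snd.ae (ae_posDef_posDefVolume k)

lemma measurable_niwKernel {k : ℕ} (d : ℝ) {Sstar : (Fin k → ℝ) → Matrix (Fin k) (Fin k) ℝ}
    (hS : Measurable Sstar) : Measurable (niwKernel d Sstar) := by
  have h1 : Measurable fun T : Matrix (Fin k) (Fin k) ℝ => T.det :=
    Continuous.measurable (by fun_prop)
  have h2 : Measurable fun q : Matrix (Fin k) (Fin k) ℝ × Matrix (Fin k) (Fin k) ℝ =>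
      (q.1 * q.2).trace := Continuous.measurable (by fun_prop)
  have h3 := h2.comp (((measurable_matrix_inv k).comp measurable_snd).prodMk
    (hS.comp measurable_fst))
  exact ((h1.comp measurable_snd).pow_const _).mul (h3.neg.div_const 2).exp

lemma measurable_optWeights {k p : ℕ} (L : Matrix (Fin p) (Fin k) ℝ) (γ : ℝ) (W rf : ℕ → ℝ)
    (T t : ℕ) : Measurable fun θ : (Fin k → ℝ) × Matrix (Fin k) (Fin k) ℝ =>
      L *ᵥ optWeights γ W rf T t θ := by
  have h : Continuous fun θ : (Fin k → ℝ) × Matrix (Fin k) (Fin k) ℝ =>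
      L *ᵥ (riskCoeff γ W rf T t • (θ.2 *ᵥ (θ.1 - rf (t + 1) • (1 : Fin k → ℝ)))) := by
    fun_prop
  have h2 : Measurable fun θ : (Fin k → ℝ) × Matrix (Fin k) (Fin k) ℝ => (θ.1, θ.2⁻¹) :=
    measurable_fst.prodMk ((measurable_matrix_inv k).comp measurable_snd)
  have h3 := h.measurable.comp h2
  simp only [Function.comp_def] at h3
  simpa only [optWeights] using h3

lemma measurable_stochRep {k p : ℕ} (C ρ : ℝ) (L : Matrix (Fin p) (Fin k) ℝ)
    {Sstar : (Fin k → ℝ) → Matrix (Fin k) (Fin k) ℝ} (hS : Measurable Sstar) :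
    Measurable (stochRep C ρ L Sstar) := by
  have hV : Measurable fun ω : ℝ × EuclideanSpace ℝ (Fin p) × (Fin k → ℝ) => (Sstar ω.2.2)⁻¹ :=
    (measurable_matrix_inv k).comp (hS.comp measurable_snd.snd)
  have hv : Measurable fun ω : ℝ × EuclideanSpace ℝ (Fin p) × (Fin k → ℝ) =>
      ω.2.2 - ρ • (1 : Fin k → ℝ) := measurable_snd.snd.sub measurable_const
  have hmean : Continuous fun q : Matrix (Fin k) (Fin k) ℝ × (Fin k → ℝ) =>
      (L * q.1) *ᵥ q.2 := by fun_prop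
  have hcov : Continuous fun q : Matrix (Fin k) (Fin k) ℝ × (Fin k → ℝ) =>
      portfolioCov L q.1 q.2 := by
    unfold portfolioCov
    simp only [vecMulVec_eq Unit]
    fun_prop
  have hmul : Continuous fun q : Matrix (Fin p) (Fin p) ℝ × (Fin p → ℝ) => q.1 *ᵥ q.2 := by
    fun_prop
  have hz : Measurable fun ω : ℝ × EuclideanSpace ℝ (Fin p) × (Fin k → ℝ) => ω.2.1.ofLp := by
    fun_prop
  exact ((measurable_fst.const_mul C).smul (hmean.measurable.comp (hV.prodMk hv))).add
    ((measurable_fst.sqrt.const_mul C).smul (hmul.measurable.comp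
      (((measurable_matrix_sqrt p).comp (hcov.measurable.comp (hV.prodMk hv))).prodMk hz)))

/-- `S*(μ) = S + r (μ - m)(μ - m)ᵀ`. -/
def scaleStar {k : ℕ} (S : Matrix (Fin k) (Fin k) ℝ) (r : ℝ) (m μ : Fin k → ℝ) :
    Matrix (Fin k) (Fin k) ℝ :=
  S + r • vecMulVec (μ - m) (μ - m)

lemma measurable_scaleStar {k : ℕ} (S : Matrix (Fin k) (Fin k) ℝ) (r : ℝ) (m : Fin k → ℝ) :
    Measurable (scaleStar S r m) := by
  have : Continuous (scaleStar S r m) := by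
    unfold scaleStar
    simp only [vecMulVec_eq Unit]
    fun_prop
  exact this.measurable

/-- The law of the triple `(η, z₀, μ)`. -/
def mixingLaw {k : ℕ} (p : ℕ) (ν δ r : ℝ) (m : Fin k → ℝ) (S : Matrix (Fin k) (Fin k) ℝ) :
    Measure (ℝ × EuclideanSpace ℝ (Fin p) × (Fin k → ℝ)) :=
  (chiSquared ν).prod ((multivariateGaussian 0 1).prod (multiT δ m ((r * δ)⁻¹ • S)))

/-- `G` tests `μ` and the weights jointly, so that the law of each can be read off. Integrating over
`Σ` first leaves `|S*(μ)|^(-ν/2)` times an average over `(η, z)` whose law is free of `μ`. -/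
lemma lintegral_niwKernel {k p : ℕ} {d ν δ r : ℝ} (hd : d = ν + k + 2)
    (hδ : ν = δ + (k + 1 : ℕ)) (hδ0 : 0 < δ) (hr : 0 < r)
    {S : Matrix (Fin (k + 1)) (Fin (k + 1)) ℝ} (hS : S.PosDef) (m : Fin (k + 1) → ℝ)
    (L : Matrix (Fin p) (Fin (k + 1)) ℝ) (γ : ℝ) (W rf : ℕ → ℝ) (T t : ℕ)
    {G : (Fin (k + 1) → ℝ) × (Fin p → ℝ) → ℝ≥0∞} (hG : Measurable G) :
    ∫⁻ θ, ENNReal.ofReal (niwKernel d (scaleStar S r m) θ) *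
        G (θ.1, L *ᵥ optWeights γ W rf T t θ) ∂refMeasure (k + 1) =
      invWishartConst (k + 1) d * ((ENNReal.ofReal (tConst δ r S))⁻¹ *
        ∫⁻ ω, G (ω.2.2, stochRep (riskCoeff γ W rf T t) (rf (t + 1)) L (scaleStar S r m) ω)
          ∂mixingLaw p ν δ r m S) := by
  have hν : 0 < ν := by rw [hδ]; positivity
  have := isProbabilityMeasure_chiSquared hν
  have := isProbabilityMeasure_multiT hS m hr hδ0
  set C := riskCoeff γ W rf T t with hC
  set ρ := rf (t + 1) with hρ
  have hSm := measurable_scaleStar S r m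
  have hrep := measurable_stochRep C ρ L hSm
  have hω : Measurable fun ω : ℝ × EuclideanSpace ℝ (Fin p) × (Fin (k + 1) → ℝ) =>
      G (ω.2.2, stochRep C ρ L (scaleStar S r m) ω) :=
    hG.comp (measurable_snd.snd.prodMk hrep)
  have hm : Measurable fun θ : (Fin (k + 1) → ℝ) × Matrix (Fin (k + 1)) (Fin (k + 1)) ℝ =>
      ENNReal.ofReal (niwKernel d (scaleStar S r m) θ) *
        G (θ.1, L *ᵥ optWeights γ W rf T t θ) :=
    (measurable_niwKernel d hSm).ennreal_ofReal.mul
      (hG.comp (measurable_fst.prodMk (measurable_optWeights L γ W rf T t)))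
  have hcond : ∀ μ : Fin (k + 1) → ℝ,
      ∫⁻ Q, ENNReal.ofReal (niwKernel d (scaleStar S r m) (μ, Q)) *
        G (μ, L *ᵥ optWeights γ W rf T t (μ, Q)) ∂posDefVolume (k + 1) =
      invWishartConst (k + 1) d * (ENNReal.ofReal ((scaleStar S r m μ).det ^ (-ν / 2)) *
        ∫⁻ η, ∫⁻ z, G (μ, stochRep C ρ L (scaleStar S r m) (η, z, μ))
          ∂(multivariateGaussian 0 1) ∂chiSquared ν) := by
    intro μ
    have hF : Measurable fun y : Fin p → ℝ => G (μ, C • y) :=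
      hG.comp (measurable_const.prodMk (measurable_const_smul C))
    have hPD : (scaleStar S r m μ).PosDef := posDef_add_smul_vecMulVec hS hr.le _
    have h := lintegral_invWishart hd hν L hPD (μ - ρ • 1) hF
    have hlhs : ∀ Q : Matrix (Fin (k + 1)) (Fin (k + 1)) ℝ,
        L *ᵥ optWeights γ W rf T t (μ, Q) = C • (L *ᵥ (Q⁻¹ *ᵥ (μ - ρ • 1))) := fun Q => by
      rw [optWeights, Matrix.mulVec_smul]
    simp only [hlhs, niwKernel]
    rw [h]
    congr 2
    refine lintegral_congr fun η => ?_
    have hz : Measurable fun z : Fin p → ℝ => G (μ, C • (η • ((L * (scaleStar S r m μ)⁻¹) *ᵥ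
        (μ - ρ • 1)) + √η • (CFC.sqrt (portfolioCov L (scaleStar S r m μ)⁻¹ (μ - ρ • 1)) *ᵥ z))) := by
      have hc : Continuous fun z : Fin p → ℝ => η • ((L * (scaleStar S r m μ)⁻¹) *ᵥ
        (μ - ρ • 1)) + √η • (CFC.sqrt (portfolioCov L (scaleStar S r m μ)⁻¹ (μ - ρ • 1)) *ᵥ z) := by
        fun_prop
      exact hF.comp hc.measurable
    rw [← lintegral_multivariateGaussian_zero_one hz]
    refine lintegral_congr fun z => ?_
    rw [smul_add, smul_smul, smul_smul]
    rfl
  rw [refMeasure_eq, lintegral_prod _ hm.aemeasurable]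
  simp only [hcond]
  have hK := invWishartConst_ne_zero_and_ne_top (k + 1) (d := d)
    (by rw [hd, hδ]; push_cast; linarith)
  rw [lintegral_const_mul' _ _ hK.2]
  congr 1
  have ht := tConst_pos hS hr hδ0
  have hdens : Measurable fun μ : Fin (k + 1) → ℝ =>
      ∫⁻ η, ∫⁻ z, G (μ, stochRep C ρ L (scaleStar S r m) (η, z, μ))
        ∂(multivariateGaussian 0 1) ∂chiSquared ν := by
    have h1 : Measurable fun q : ((Fin (k + 1) → ℝ) × ℝ) × EuclideanSpace ℝ (Fin p) =>
        G (q.1.1, stochRep C ρ L (scaleStar S r m) (q.1.2, q.2, q.1.1)) :=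
      hω.comp (measurable_fst.snd.prodMk (measurable_snd.prodMk measurable_fst.fst))
    exact h1.lintegral_prod_right'.lintegral_prod_right'
  -- Since `ν = δ + (k + 1)`, the remaining determinant power is exactly the `t` kernel with `δ`
  -- degrees of freedom.
  have hT := lintegral_multiT hS m hr hδ0 hdens
  rw [← hδ] at hT
  have hT' := congrArg (fun s => (ENNReal.ofReal (tConst δ r S))⁻¹ * s) hT
  simp only [← mul_assoc] at hT'
  rw [ENNReal.inv_mul_cancel (ENNReal.ofReal_pos.2 ht).ne' ENNReal.ofReal_ne_top, one_mul] at hT'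
  refine hT'.symm.trans ?_
  congr 1
  rw [mixingLaw, lintegral_prod _ hω.aemeasurable]
  have h1 : Measurable fun q : (Fin (k + 1) → ℝ) × ℝ =>
      ∫⁻ z, G (q.1, stochRep C ρ L (scaleStar S r m) (q.2, z, q.1))
        ∂(multivariateGaussian (0 : EuclideanSpace ℝ (Fin p)) 1) := by
    have h1 : Measurable fun q : ((Fin (k + 1) → ℝ) × ℝ) × EuclideanSpace ℝ (Fin p) =>
        G (q.1.1, stochRep C ρ L (scaleStar S r m) (q.1.2, q.2, q.1.1)) :=
      hω.comp (measurable_fst.snd.prodMk (measurable_snd.prodMk measurable_fst.fst))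
    exact h1.lintegral_prod_right'
  rw [lintegral_lintegral_swap h1.aemeasurable]
  refine lintegral_congr fun η => ?_
  have h2 : Measurable fun y : EuclideanSpace ℝ (Fin p) × (Fin (k + 1) → ℝ) =>
      G (y.2, stochRep C ρ L (scaleStar S r m) (η, y)) := hω.comp measurable_prodMk_left
  exact (lintegral_prod_symm _ h2.aemeasurable).symm

/-! ### From the kernel to the posterior -/

lemma measurable_normalDensity (k : ℕ) :
    Measurable fun q : (Fin k → ℝ) × Matrix (Fin k) (Fin k) ℝ × (Fin k → ℝ) =>
      normalDensity q.1 q.2.1 q.2.2 := by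
  have h1 : Measurable fun T : Matrix (Fin k) (Fin k) ℝ => T.det :=
    Continuous.measurable (by fun_prop)
  have h2 : Measurable fun q : Matrix (Fin k) (Fin k) ℝ × (Fin k → ℝ) => q.2 ⬝ᵥ (q.1 *ᵥ q.2) :=
    Continuous.measurable (by fun_prop)
  have h3 := h2.comp (((measurable_matrix_inv k).comp
    (measurable_snd.fst (f := fun q : (Fin k → ℝ) × Matrix (Fin k) (Fin k) ℝ × (Fin k → ℝ) => q.2)
      )).prodMk (measurable_snd.snd.sub measurable_fst))
  exact (((h1.comp measurable_snd.fst).pow_const _).const_mul _).mul (h3.neg.div_const 2).exp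

lemma measurable_likelihood {k n : ℕ} (x : Fin n → Fin k → ℝ) : Measurable (likelihood x) := by
  have h : ∀ i, Measurable fun θ : (Fin k → ℝ) × Matrix (Fin k) (Fin k) ℝ =>
      normalDensity θ.1 θ.2 (x i) := fun i => by
    have h1 : Measurable fun θ : (Fin k → ℝ) × Matrix (Fin k) (Fin k) ℝ => (θ.1, θ.2, x i) :=
      measurable_fst.prodMk (measurable_snd.prodMk measurable_const)
    have h2 := (measurable_normalDensity k).comp h1
    simpa only [Function.comp_def] using h2
  unfold likelihood
  exact Finset.measurable_prod _ fun i _ => h i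

/-- If prior times likelihood is proportional to a normal-inverse-Wishart kernel, the posterior is
proper, the marginal of `μ` is a `t`-distribution, and the portfolio weights have the
stochastic representation in terms of `χ²`, normal and `t`-distributed variables. -/
theorem posterior_of_niwKernel {k n p : ℕ} {d ν δ r : ℝ} (hd : d = ν + k + 2)
    (hδ : ν = δ + (k + 1 : ℕ)) (hδ0 : 0 < δ) (hr : 0 < r)
    {S : Matrix (Fin (k + 1)) (Fin (k + 1)) ℝ} (hS : S.PosDef) (m : Fin (k + 1) → ℝ)
    (L : Matrix (Fin p) (Fin (k + 1)) ℝ) (γ : ℝ) (W rf : ℕ → ℝ) (T t : ℕ)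
    (x : Fin n → Fin (k + 1) → ℝ)
    {f : (Fin (k + 1) → ℝ) × Matrix (Fin (k + 1)) (Fin (k + 1)) ℝ → ℝ} (hf : Measurable f)
    (hf0 : ∀ θ, θ.2.PosDef → 0 ≤ f θ) {κ : ℝ} (hκ : 0 < κ)
    (hfac : ∀ θ, θ.2.PosDef → f θ * likelihood x θ = κ * niwKernel d (scaleStar S r m) θ)
    {prior : Measure ((Fin (k + 1) → ℝ) × Matrix (Fin (k + 1)) (Fin (k + 1)) ℝ)}
    (hprior : prior = (refMeasure (k + 1)).withDensity fun θ => ENNReal.ofReal (f θ)) :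
    IsProbabilityMeasure (posterior prior x) ∧
      (posterior prior x).map Prod.fst = multiT δ m ((r * δ)⁻¹ • S) ∧
      IdentDistrib (fun θ => L *ᵥ optWeights γ W rf T t θ)
        (stochRep (riskCoeff γ W rf T t) (rf (t + 1)) L (scaleStar S r m))
        (posterior prior x)
        ((chiSquared ν).prod ((multivariateGaussian 0 1).prod
          (multiT δ m ((r * δ)⁻¹ • S)))) := by
  have hν : 0 < ν := by rw [hδ]; positivity
  have := isProbabilityMeasure_chiSquared hν
  have := isProbabilityMeasure_multiT hS m hr hδ0
  have hmix : IsProbabilityMeasure (mixingLaw p ν δ r m S) := by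
    unfold mixingLaw
    infer_instance
  set Y : (Fin (k + 1) → ℝ) × Matrix (Fin (k + 1)) (Fin (k + 1)) ℝ → Fin p → ℝ :=
    fun θ => L *ᵥ optWeights γ W rf T t θ with hY
  set R := stochRep (riskCoeff γ W rf T t) (rf (t + 1)) L (scaleStar S r m) with hR
  have hYm : Measurable Y := measurable_optWeights L γ W rf T t
  have hRm : Measurable R := measurable_stochRep _ _ L (measurable_scaleStar S r m)
  have hlik := (measurable_likelihood x).ennreal_ofReal
  set Z : ℝ≥0∞ := ENNReal.ofReal κ * (invWishartConst (k + 1) d *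
    (ENNReal.ofReal (tConst δ r S))⁻¹) with hZ
  have hprod : ∀ {G : (Fin (k + 1) → ℝ) × (Fin p → ℝ) → ℝ≥0∞}, Measurable G →
      ∫⁻ θ, ENNReal.ofReal (likelihood x θ) * G (θ.1, Y θ) ∂prior =
        Z * ∫⁻ ω, G (ω.2.2, R ω) ∂mixingLaw p ν δ r m S := by
    intro G hG
    have hGm : Measurable fun θ => G (θ.1, Y θ) := hG.comp (measurable_fst.prodMk hYm)
    have hm : Measurable fun θ => ENNReal.ofReal (likelihood x θ) * G (θ.1, Y θ) :=
      hlik.mul hGm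
    rw [hprior, lintegral_withDensity_eq_lintegral_mul _ hf.ennreal_ofReal hm, hZ,
      mul_assoc, mul_assoc, ← lintegral_niwKernel hd hδ hδ0 hr hS m L γ W rf T t hG,
      ← lintegral_const_mul' _ _ ENNReal.ofReal_ne_top]
    refine lintegral_congr_ae ((ae_posDef_refMeasure (k + 1)).mono fun θ hθ => ?_)
    simp only [Pi.mul_apply]
    rw [← mul_assoc, ← mul_assoc, ← ENNReal.ofReal_mul (hf0 θ hθ), hfac θ hθ,
      ENNReal.ofReal_mul hκ.le]
  have hK := invWishartConst_ne_zero_and_ne_top (k + 1) (d := d)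
    (by rw [hd, hδ]; push_cast; linarith)
  have htc : ENNReal.ofReal (tConst δ r S) ≠ 0 :=
    (ENNReal.ofReal_pos.2 (tConst_pos hS hr hδ0)).ne'
  have hZ0 : Z ≠ 0 := mul_ne_zero (ENNReal.ofReal_pos.2 hκ).ne'
    (mul_ne_zero hK.1 (ENNReal.inv_ne_zero.2 ENNReal.ofReal_ne_top))
  have hZt : Z ≠ ∞ := ENNReal.mul_ne_top ENNReal.ofReal_ne_top
    (ENNReal.mul_ne_top hK.2 (ENNReal.inv_ne_top.2 htc))
  have hnorm : ∫⁻ θ, ENNReal.ofReal (likelihood x θ) ∂prior = Z := by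
    have h := hprod (G := fun _ => 1) measurable_const
    simpa using h
  -- All three conclusions follow from this identity: take `G` constant, a function of `μ` alone, or
  -- a function of the weights alone.
  have hpost : ∀ {G : (Fin (k + 1) → ℝ) × (Fin p → ℝ) → ℝ≥0∞}, Measurable G →
      ∫⁻ θ, G (θ.1, Y θ) ∂posterior prior x = ∫⁻ ω, G (ω.2.2, R ω) ∂mixingLaw p ν δ r m S := by
    intro G hG
    have hGm : Measurable fun θ => G (θ.1, Y θ) := hG.comp (measurable_fst.prodMk hYm)
    rw [posterior, hnorm, lintegral_smul_measure,
      lintegral_withDensity_eq_lintegral_mul _ hlik hGm]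
    have h := hprod hG
    simp only [Pi.mul_apply, smul_eq_mul] at h ⊢
    rw [h, ← mul_assoc, ENNReal.inv_mul_cancel hZ0 hZt, one_mul]
  refine ⟨⟨?_⟩, ?_, hYm.aemeasurable, hRm.aemeasurable, ?_⟩
  · have h := hpost (G := fun _ => 1) measurable_const
    simpa using h
  · refine Measure.ext_of_lintegral _ fun g hg => ?_
    have h := hpost (G := fun q => g q.1) (hg.comp measurable_fst)
    have h1 : Measurable fun ω : ℝ × EuclideanSpace ℝ (Fin p) × (Fin (k + 1) → ℝ) => g ω.2.2 :=
      hg.comp measurable_snd.snd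
    have h2 : Measurable fun ω : EuclideanSpace ℝ (Fin p) × (Fin (k + 1) → ℝ) => g ω.2 :=
      hg.comp measurable_snd
    rw [lintegral_map hg measurable_fst, h, mixingLaw, lintegral_prod _ h1.aemeasurable]
    simp only [lintegral_const, measure_univ, mul_one]
    rw [lintegral_prod _ h2.aemeasurable]
    simp only [lintegral_const, measure_univ, mul_one]
  · refine Measure.ext_of_lintegral _ fun g hg => ?_
    have h := hpost (G := fun q => g q.2) (hg.comp measurable_snd)
    rw [lintegral_map hg hYm, lintegral_map hg hRm, h]
    rfl

/-! ### Completing the square -/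

lemma dotProduct_mulVec_eq_trace {k : ℕ} (A : Matrix (Fin k) (Fin k) ℝ) (u : Fin k → ℝ) :
    u ⬝ᵥ (A *ᵥ u) = (A * vecMulVec u u).trace := by
  rw [Matrix.mul_vecMulVec, Matrix.trace_vecMulVec, dotProduct_comm]

lemma sum_vecMulVec_sub {k n : ℕ} (hn : 1 < n) (x : Fin n → Fin k → ℝ) (μ : Fin k → ℝ) :
    ∑ i, vecMulVec (x i - μ) (x i - μ) = scaleDStar x μ := by
  have hn0 : (n : ℝ) ≠ 0 := by positivity
  have hn1 : (n : ℝ) - 1 ≠ 0 := by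
    have : (1 : ℝ) < n := by exact_mod_cast hn
    linarith
  rw [scaleDStar, scaleD, sampleCov, smul_smul, mul_inv_cancel₀ hn1, one_smul]
  ext a b
  have hs : ∀ c, ∑ i, x i c = n * sampleMean x c := by
    intro c
    simp [sampleMean, Finset.sum_apply]
    field_simp
  simp only [Matrix.add_apply, Matrix.smul_apply, Matrix.sum_apply, vecMulVec_apply, Pi.sub_apply,
    smul_eq_mul]
  -- The expansion about an arbitrary centre is applied at `μ` and at the sample mean.
  have hexp : ∀ (y : Fin k → ℝ), ∑ i, (x i a - y a) * (x i b - y b) =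
      ∑ i, x i a * x i b - n * sampleMean x a * y b - n * sampleMean x b * y a +
        n * (y a * y b) := by
    intro y
    have : ∀ i, (x i a - y a) * (x i b - y b) =
        x i a * x i b - x i a * y b - x i b * y a + y a * y b := fun i => by ring
    simp only [this, Finset.sum_add_distrib, Finset.sum_sub_distrib, ← Finset.sum_mul, hs,
      Finset.sum_const, Finset.card_univ, Fintype.card_fin, nsmul_eq_mul]
    ring
  rw [hexp, hexp]
  ring

lemma likelihood_eq {k n : ℕ} (hn : 1 < n) (x : Fin n → Fin k → ℝ)
    (θ : (Fin k → ℝ) × Matrix (Fin k) (Fin k) ℝ) (hθ : θ.2.PosDef) :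
    likelihood x θ = ((2 * Real.pi) ^ (-(k : ℝ) / 2)) ^ n * θ.2.det ^ (-(n : ℝ) / 2) *
      Real.exp (-(θ.2⁻¹ * scaleDStar x θ.1).trace / 2) := by
  have hdet := hθ.det_pos
  simp only [likelihood, normalDensity, Finset.prod_mul_distrib, Finset.prod_const,
    Finset.card_univ, Fintype.card_fin, ← Real.exp_sum]
  congr 2
  · rw [← Real.rpow_natCast, ← Real.rpow_mul hdet.le]
    congr 1; ring
  · rw [← sum_vecMulVec_sub hn, Finset.mul_sum, Matrix.trace_sum, ← Finset.sum_div,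
      ← Finset.sum_neg_distrib]
    simp only [dotProduct_mulVec_eq_trace]

/-- Completing the square in `μ`: the terms centred at `m₀` and at `x̄` merge into one centred at
their weighted mean, plus a remainder free of `μ`. -/
lemma scaleCStar_eq {k n : ℕ} (m₀ : Fin k → ℝ) {r₀ : ℝ} (hr₀ : 0 < r₀)
    (S₀ : Matrix (Fin k) (Fin k) ℝ) (x : Fin n → Fin k → ℝ) (μ : Fin k → ℝ) :
    r₀ • vecMulVec (μ - m₀) (μ - m₀) + S₀ + scaleDStar x μ = scaleCStar m₀ r₀ S₀ x μ := by
  have h : (n : ℝ) + r₀ ≠ 0 := by positivity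
  ext a b
  simp only [scaleCStar, scaleC, scaleDStar, meanC, Matrix.add_apply, Matrix.smul_apply,
    vecMulVec_apply, Pi.sub_apply, Pi.smul_apply, Pi.add_apply, smul_eq_mul]
  field_simp
  ring

lemma posSemidef_scaleD {k n : ℕ} (hn : 1 < n) (x : Fin n → Fin k → ℝ) :
    (scaleD x).PosSemidef := by
  have h := sum_vecMulVec_sub hn x (sampleMean x)
  have h2 : scaleDStar x (sampleMean x) = scaleD x := by
    rw [scaleDStar, sub_self]
    simp
  rw [← h2, ← h]
  exact Matrix.posSemidef_sum _ fun i _ => posSemidef_vecMulVec_self _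

lemma posDef_scaleC {k n : ℕ} (hn : 1 < n) (m₀ : Fin k → ℝ) {r₀ : ℝ} (hr₀ : 0 < r₀)
    {S₀ : Matrix (Fin k) (Fin k) ℝ} (hS₀ : S₀.PosDef) (x : Fin n → Fin k → ℝ) :
    (scaleC m₀ r₀ S₀ x).PosDef :=
  posDef_add_smul_vecMulVec (hS₀.posSemidef_add (posSemidef_scaleD hn x)) (by positivity) _

/-! ### The conjugate prior density -/

lemma measurable_invWishartDensity {k : ℕ} (d : ℝ) (Ψ : Matrix (Fin k) (Fin k) ℝ) :
    Measurable (invWishartDensity d Ψ) := by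
  have h1 : Measurable fun T : Matrix (Fin k) (Fin k) ℝ => T.det :=
    Continuous.measurable (by fun_prop)
  have h2 : Measurable fun T : Matrix (Fin k) (Fin k) ℝ => (T * Ψ).trace :=
    Continuous.measurable (by fun_prop)
  have h3 := h2.comp (measurable_matrix_inv k)
  exact ((h1.pow_const _).const_mul _).mul (h3.neg.div_const 2).exp

lemma measurable_normalDensity_smul {k : ℕ} (m : Fin k → ℝ) (a : ℝ) :
    Measurable fun θ : (Fin k → ℝ) × Matrix (Fin k) (Fin k) ℝ =>
      normalDensity m (a • θ.2) θ.1 := by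
  have hs : Measurable fun T : Matrix (Fin k) (Fin k) ℝ => a • T :=
    Continuous.measurable (by fun_prop)
  have h1 : Measurable fun θ : (Fin k → ℝ) × Matrix (Fin k) (Fin k) ℝ => (m, a • θ.2, θ.1) :=
    measurable_const.prodMk ((hs.comp measurable_snd).prodMk measurable_fst)
  have h2 := (measurable_normalDensity k).comp h1
  simpa only [Function.comp_def] using h2

/-- The smallest Gamma argument is `a - (k - 1)/2`, positive exactly under the hypothesis. -/
lemma multiGamma_pos {k : ℕ} {a : ℝ} (ha : (k : ℝ) < 2 * a + 1) : 0 < multiGamma k a := by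
  refine mul_pos (Real.rpow_pos_of_pos Real.pi_pos _) (Finset.prod_pos fun i _ => ?_)
  refine Real.Gamma_pos_of_pos ?_
  have : ((i : ℕ) : ℝ) + 1 ≤ k := by exact_mod_cast i.2
  linarith

/-- The constant in the conjugate prior density. -/
def conjugateConst {k : ℕ} (r₀ d₀ : ℝ) (S₀ : Matrix (Fin k) (Fin k) ℝ) : ℝ :=
  (2 * Real.pi) ^ (-(k : ℝ) / 2) * (r₀⁻¹ ^ k) ^ (-(1 : ℝ) / 2) *
    (S₀.det ^ ((d₀ - k - 1) / 2) /
      (2 ^ ((k : ℝ) * (d₀ - k - 1) / 2) * multiGamma k ((d₀ - k - 1) / 2)))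

lemma conjugateConst_pos {k : ℕ} {r₀ d₀ : ℝ} {S₀ : Matrix (Fin k) (Fin k) ℝ} (hr₀ : 0 < r₀)
    (hd₀ : 2 * (k : ℝ) < d₀) (hS₀ : S₀.PosDef) : 0 < conjugateConst r₀ d₀ S₀ := by
  have h1 := multiGamma_pos (k := k) (a := (d₀ - k - 1) / 2) (by linarith)
  have h2 := hS₀.det_pos
  have := Real.pi_pos
  unfold conjugateConst
  positivity

lemma conjugate_density_eq {k : ℕ} (m₀ : Fin k → ℝ) {r₀ : ℝ} (hr₀ : 0 < r₀) (d₀ : ℝ)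
    (S₀ : Matrix (Fin k) (Fin k) ℝ) (θ : (Fin k → ℝ) × Matrix (Fin k) (Fin k) ℝ)
    (hθ : θ.2.PosDef) :
    normalDensity m₀ (r₀⁻¹ • θ.2) θ.1 * invWishartDensity d₀ S₀ θ.2 =
      conjugateConst r₀ d₀ S₀ * θ.2.det ^ (-(d₀ + 1) / 2) *
        Real.exp (-(θ.2⁻¹ * (r₀ • vecMulVec (θ.1 - m₀) (θ.1 - m₀) + S₀)).trace / 2) := by
  have hdet := hθ.det_pos
  have hinv : (r₀⁻¹ • θ.2)⁻¹ = r₀ • θ.2⁻¹ := by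
    refine Matrix.inv_eq_right_inv ?_
    rw [Matrix.smul_mul, Matrix.mul_smul, Matrix.mul_nonsing_inv _ hdet.ne'.isUnit, smul_smul,
      inv_mul_cancel₀ hr₀.ne', one_smul]
  have hexp : Real.exp (-(θ.2⁻¹ * (r₀ • vecMulVec (θ.1 - m₀) (θ.1 - m₀) + S₀)).trace / 2) =
      Real.exp (-((θ.1 - m₀) ⬝ᵥ ((r₀⁻¹ • θ.2)⁻¹ *ᵥ (θ.1 - m₀))) / 2) *
        Real.exp (-(θ.2⁻¹ * S₀).trace / 2) := by
    rw [← Real.exp_add, hinv, dotProduct_mulVec_eq_trace, Matrix.mul_add, Matrix.trace_add,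
      Matrix.mul_smul, Matrix.smul_mul]
    congr 1; ring
  have hpow : θ.2.det ^ (-(d₀ + 1) / 2) = θ.2.det ^ (-(1 : ℝ) / 2) * θ.2.det ^ (-d₀ / 2) := by
    rw [← Real.rpow_add hdet]
    congr 1; ring
  have hd : (r₀⁻¹ • θ.2).det ^ (-(1 : ℝ) / 2) =
      (r₀⁻¹ ^ k) ^ (-(1 : ℝ) / 2) * θ.2.det ^ (-(1 : ℝ) / 2) := by
    rw [Matrix.det_smul, Fintype.card_fin, Real.mul_rpow (by positivity) hdet.le]
  rw [normalDensity, invWishartDensity, hd, hexp, hpow, conjugateConst]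
  ring

end BayesPortfolio

end

open BayesPortfolio in
/-- Both parts assert that the posterior is a probability measure, that its `μ`-marginal is the
stated `t`-distribution, and that `L w_t` under the posterior is equal in distribution to the
representation built from mutually independent `η`, `z₀`, `μ` with the stated laws. -/
theorem theorem1 {k n p : ℕ} (hk : 0 < k) (hn : k < n)
    (L : Matrix (Fin p) (Fin k) ℝ) (x : Fin n → Fin k → ℝ)
    (γ : ℝ) (hγ : 0 < γ) (W rf : ℕ → ℝ) (T t : ℕ) (ht : t < T) :
    ((scaleD x).PosDef →
      IsProbabilityMeasure (posterior (diffusePrior k) x) ∧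
      (posterior (diffusePrior k) x).map Prod.fst =
        multiT ((n : ℝ) - k) (sampleMean x) (((n : ℝ) * ((n : ℝ) - k))⁻¹ • scaleD x) ∧
      IdentDistrib
        (fun θ => L *ᵥ optWeights γ W rf T t θ)
        (stochRep (riskCoeff γ W rf T t) (rf (t + 1)) L (scaleDStar x))
        (posterior (diffusePrior k) x)
        ((chiSquared n).prod ((multivariateGaussian 0 1).prod
          (multiT ((n : ℝ) - k) (sampleMean x) (((n : ℝ) * ((n : ℝ) - k))⁻¹ • scaleD x))))) ∧
    (∀ (m₀ : Fin k → ℝ) (r₀ d₀ : ℝ) (S₀ : Matrix (Fin k) (Fin k) ℝ),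
      0 < r₀ → 2 * (k : ℝ) < d₀ → S₀.PosDef →
      IsProbabilityMeasure (posterior (conjugatePrior m₀ r₀ d₀ S₀) x) ∧
      (posterior (conjugatePrior m₀ r₀ d₀ S₀) x).map Prod.fst =
        multiT ((n : ℝ) + d₀ - 2 * k) (meanC m₀ r₀ x)
          ((((n : ℝ) + r₀) * ((n : ℝ) + d₀ - 2 * k))⁻¹ • scaleC m₀ r₀ S₀ x) ∧
      IdentDistrib
        (fun θ => L *ᵥ optWeights γ W rf T t θ)
        (stochRep (riskCoeff γ W rf T t) (rf (t + 1)) L (scaleCStar m₀ r₀ S₀ x))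
        (posterior (conjugatePrior m₀ r₀ d₀ S₀) x)
        ((chiSquared ((n : ℝ) + d₀ - k)).prod ((multivariateGaussian 0 1).prod
          (multiT ((n : ℝ) + d₀ - 2 * k) (meanC m₀ r₀ x)
            ((((n : ℝ) + r₀) * ((n : ℝ) + d₀ - 2 * k))⁻¹ • scaleC m₀ r₀ S₀ x))))) := by

  -- The dimension is written as a successor so that a first row and column can be split off.
  obtain ⟨k, rfl⟩ : ∃ j, k = j + 1 := ⟨k - 1, by omega⟩
  have hn1 : 1 < n := by omega
  have hkn : ((k + 1 : ℕ) : ℝ) < n := by exact_mod_cast hn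
  have hn0 : (0 : ℝ) < n := by positivity
  have hpi := Real.pi_pos
  refine ⟨fun hS => ?_, fun m₀ r₀ d₀ S₀ hr₀ hd₀ hS₀ => ?_⟩
  -- In dimension `k + 1` the prior contributes `k + 2` to `d` and the likelihood `n`, so `ν = n`.
  · refine posterior_of_niwKernel (d := n + k + 2) (r := n)
      (κ := ((2 * Real.pi) ^ (-((k + 1 : ℕ) : ℝ) / 2)) ^ n) rfl (by ring) (by linarith) hn0 hS
      (sampleMean x) L γ W rf T t x
      (f := fun θ => θ.2.det ^ (-(((k + 1 : ℕ) : ℝ) + 1) / 2)) ?_ (fun θ hθ => ?_)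
      (by positivity) (fun θ hθ => ?_) rfl
    · have h1 : Measurable fun T : Matrix (Fin (k + 1)) (Fin (k + 1)) ℝ => T.det :=
        Continuous.measurable (by fun_prop)
      exact (h1.comp measurable_snd).pow_const _
    · have := hθ.det_pos
      positivity
    · rw [likelihood_eq hn1 x θ hθ, niwKernel]
      have hpow : θ.2.det ^ (-((n : ℝ) + k + 2) / 2) =
          θ.2.det ^ (-(((k + 1 : ℕ) : ℝ) + 1) / 2) * θ.2.det ^ (-(n : ℝ) / 2) := by
        rw [← Real.rpow_add hθ.det_pos]
        congr 1
        push_cast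
        ring
      rw [hpow]
      simp only [scaleDStar, scaleStar]
      ring
  · have hd₁ : d₀ > 2 * ((k + 1 : ℕ) : ℝ) := hd₀
    -- The summand `1` in `d` comes from the factor `|Σ|^(-1/2)` in the normal density of `μ` given
    -- `Σ`.
    refine posterior_of_niwKernel (d := n + d₀ + 1) (r := n + r₀)
      (κ := conjugateConst r₀ d₀ S₀ * ((2 * Real.pi) ^ (-((k + 1 : ℕ) : ℝ) / 2)) ^ n)
      (by push_cast; ring) (by ring) (by linarith) (by positivity) (posDef_scaleC hn1 m₀ hr₀ hS₀ x)
      (meanC m₀ r₀ x) L γ W rf T t x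
      (f := fun θ => normalDensity m₀ (r₀⁻¹ • θ.2) θ.1 * invWishartDensity d₀ S₀ θ.2)
      ?_ (fun θ hθ => ?_) ?_ (fun θ hθ => ?_) rfl
    · exact (measurable_normalDensity_smul m₀ r₀⁻¹).mul
        ((measurable_invWishartDensity d₀ S₀).comp measurable_snd)
    · rw [conjugate_density_eq m₀ hr₀ d₀ S₀ θ hθ]
      have := conjugateConst_pos hr₀ hd₀ hS₀
      have := hθ.det_pos
      positivity
    · have := conjugateConst_pos hr₀ hd₀ hS₀
      positivity
    · have hstar : scaleStar (scaleC m₀ r₀ S₀ x) ((n : ℝ) + r₀) (meanC m₀ r₀ x) θ.1 =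
          r₀ • vecMulVec (θ.1 - m₀) (θ.1 - m₀) + S₀ + scaleDStar x θ.1 :=
        (scaleCStar_eq m₀ hr₀ S₀ x θ.1).symm
      rw [likelihood_eq hn1 x θ hθ, conjugate_density_eq m₀ hr₀ d₀ S₀ θ hθ, niwKernel, hstar]
      have hpow : θ.2.det ^ (-((n : ℝ) + d₀ + 1) / 2) =
          θ.2.det ^ (-(d₀ + 1) / 2) * θ.2.det ^ (-(n : ℝ) / 2) := by
        rw [← Real.rpow_add hθ.det_pos]
        congr 1
        ring
      have hexp : Real.exp (-(θ.2⁻¹ * (r₀ • vecMulVec (θ.1 - m₀) (θ.1 - m₀) + S₀ +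
          scaleDStar x θ.1)).trace / 2) =
          Real.exp (-(θ.2⁻¹ * (r₀ • vecMulVec (θ.1 - m₀) (θ.1 - m₀) + S₀)).trace / 2) *
            Real.exp (-(θ.2⁻¹ * scaleDStar x θ.1).trace / 2) := by
        rw [← Real.exp_add, Matrix.mul_add _ _ (scaleDStar x θ.1), Matrix.trace_add]
        congr 1; ring
      rw [hpow, hexp]
      ring
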